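/- There are absolute constants $C,c_0,c_1>0$ such that the following holds for all integers $1\le d\le n$ and all $\delta\in(0,1/2)$. **Model.** Let $\eta_1,\dots,\eta_n\in\{-1,1\}$ be a homogeneous binary symmetric Markov chain with flip probability $\delta$: $\eta_1$ is a Rademacher variable and, given $\eta_1,\dots,\eta_i$, one has $\eta_{i+1}=-\eta_i$ with probability $\delta$ and $\eta_{i+1}=\eta_i$ with probability $1-\delta$. Let $\xi_1,\dots,\xi_n$ be i.i.d. random vectors in $\mathbf R^d$, independent of $\eta$, isotropic ($\mathbf E\langle v,\xi_i\rangle^2=\|v\|^2$ for all $v$) and $1$-sub-Gaussian ($\mathbf E\, e^{\langle v,\xi_i\rangle}\le e^{\|v\|^2/2}$ for all $v$). For $\theta\in\mathbf R^d$ the observations are $Y_i=\eta_i\theta+\xi_i$, $i=1,\dots,n$. **Estimator.** For an integer $1\le\ell\le n$ put $k=\lfloor n/\ell\rfloor$ (so $n=k\ell$ when $\ell$ divides $n$), and let $I_i=\{(i-1)k+1,\dots,ik\}$, $i=1,\dots,\ell$; the at most $\ell-1$ observations left over are not used. Put $\tilde Y_i=\frac1k\sum_{j\in I_i}Y_j$,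 $\bar\eta_i=\frac1k\sum_{j\in I_i}\eta_j$, $\bar\eta=(\bar\eta_1,\dots,\bar\eta_\ell)$, $\hat\Sigma=\frac1\ell\sum_{i=1}^\ell\tilde Y_i\tilde Y_i^{\top}$, and $$\hat\theta(\ell)=\sqrt{\frac{\ell}{\mathbf E\|\bar\eta\|^2}\Big(\lambda_{\max}(\hat\Sigma)-\frac1k\Big)_+}\;v_{\max}(\hat\Sigma),$$ where $\lambda_{\max}$ is the top eigenvalue and $v_{\max}$ any choice of a corresponding unit eigenvector. Let $$\ell^*=d\vee\lceil n(\delta\vee\|\theta\|^2)\rceil\wedge n,\qquad \ell(a,b)=\min\{\|a-b\|,\|a+b\|\}.$$ **Claim.** For every $\theta\in\mathbf R^d$, with probability at least $1-c_1e^{-c_0d}$, $$\ell^2(\hat\theta(\ell^*),\theta)\le C\cdot\begin{cases}\sqrt{\frac{\delta d}{n}}+\frac dn, & \|\theta\|^2\le\sqrt{\frac{\delta d}{n}}\vee\frac dn,\\[4pt] \frac{\delta d/n}{\|\theta\|^2}, & \frac dn\le\delta\ \text{ and }\ \sqrt{\frac{\delta d}{n}}\vee\frac dn\le\|\theta\|^2\le\delta\vee\frac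 dn,\\[4pt] \frac dn, & \delta\vee\frac dn\le\|\theta\|^2.\end{cases}$$ Moreover, for every $\theta\in\mathbf R^d$, with probability at least $1-c_1e^{-c_0d}$, $\ell^2(\hat\theta(\ell^*),\theta)\le C\big(\sqrt{\delta d/n}+d/n\big)$. Consequently $\hat\theta(\ell^*)$ is locally and globally minimax optimal in the following sense. Let $\phi(\theta)$ be the three-regime rate above (a boundary value of $\|\theta\|^2$ being put in the first regime that contains it). Then $$\sup_{\theta}\mathbf P\big(\ell^2(\hat\theta(\ell^*),\theta)\ge C\phi(\theta)\big)\le c_1e^{-c_0d},\qquad \sup_{\theta}\mathbf P\Big(\ell^2(\hat\theta(\ell^*),\theta)\ge C\Big(\sqrt{\tfrac{\delta d}{n}}+\tfrac dn\Big)\Big)\le c_1e^{-c_0d}.$$ -/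

import Mathlib

open MeasureTheory ProbabilityTheory

noncomputable section

namespace MarkovMixture

/-- `η 0, …, η (n-1)` is a homogeneous binary symmetric Markov chain with flip probability `δ`:
the first label is Rademacher and, given any past path, the next label is the opposite of the
current one with probability `δ` and equal to it with probability `1 - δ`. -/
structure IsSymmetricChain {Ω : Type*} [MeasurableSpace Ω] (μ : Measure Ω) (δ : ℝ) {n : ℕ}
    (η : Fin n → Ω → ℝ) : Prop where
  measurable : ∀ i, Measurable (η i)
  label : ∀ i, ∀ᵐ ω ∂μ, η i ω = 1 ∨ η i ω = -1
  init : ∀ i : Fin n, (i : ℕ) = 0 →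
    μ.real {ω | η i ω = 1} = 1 / 2 ∧ μ.real {ω | η i ω = -1} = 1 / 2
  flip : ∀ i j : Fin n, (j : ℕ) = i + 1 → ∀ s : Fin n → ℝ,
    μ.real {ω | (∀ m ≤ i, η m ω = s m) ∧ η j ω = -η i ω}
      = δ * μ.real {ω | ∀ m ≤ i, η m ω = s m}
  stay : ∀ i j : Fin n, (j : ℕ) = i + 1 → ∀ s : Fin n → ℝ,
    μ.real {ω | (∀ m ≤ i, η m ω = s m) ∧ η j ω = η i ω}
      = (1 - δ) * μ.real {ω | ∀ m ≤ i, η m ω = s m}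

/-- `ξ 0, …, ξ (n-1)` are i.i.d. isotropic `1`-sub-Gaussian random vectors in `ℝ^d`. -/
structure IsSubGaussianNoise {Ω : Type*} [MeasurableSpace Ω] (μ : Measure Ω) {n d : ℕ}
    (ξ : Fin n → Ω → EuclideanSpace ℝ (Fin d)) : Prop where
  measurable : ∀ i, Measurable (ξ i)
  indep : iIndepFun ξ μ
  identDistrib : ∀ i j, IdentDistrib (ξ i) (ξ j) μ μ
  isotropic : ∀ i, ∀ v : EuclideanSpace ℝ (Fin d),
    ∫ ω, (inner ℝ v (ξ i ω)) ^ 2 ∂μ = ‖v‖ ^ 2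
  subGaussian : ∀ i, ∀ v : EuclideanSpace ℝ (Fin d),
    Integrable (fun ω => Real.exp (inner ℝ v (ξ i ω))) μ ∧
      ∫ ω, Real.exp (inner ℝ v (ξ i ω)) ∂μ ≤ Real.exp (‖v‖ ^ 2 / 2)

/-- The hidden Markov mixture model: a symmetric chain of labels and an independent noise. -/
structure IsModel {Ω : Type*} [MeasurableSpace Ω] (μ : Measure Ω) (δ : ℝ) {n d : ℕ}
    (η : Fin n → Ω → ℝ) (ξ : Fin n → Ω → EuclideanSpace ℝ (Fin d)) : Prop where
  chain : IsSymmetricChain μ δ η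
  noise : IsSubGaussianNoise μ ξ
  indep : IndepFun (fun ω i => η i ω) (fun ω i => ξ i ω) μ

/-- The observations `Y i = η i • θ + ξ i`. -/
def obs {Ω : Type*} {n d : ℕ} (η : Fin n → Ω → ℝ) (ξ : Fin n → Ω → EuclideanSpace ℝ (Fin d))
    (θ : EuclideanSpace ℝ (Fin d)) (ω : Ω) (i : Fin n) : EuclideanSpace ℝ (Fin d) :=
  η i ω • θ + ξ i ω

/-- The length `k` of a bucket; `k = n / ℓ` when `ℓ` divides `n`. -/
def bucketLength (n l : ℕ) : ℕ := n / l

/-- The `i`-th bucket `{i k, …, (i + 1) k - 1}`. If `ℓ` does not divide `n`, the last `n - k ℓ`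
observations belong to no bucket. -/
def bucket (n l : ℕ) (i : Fin l) : Finset (Fin n) :=
  Finset.univ.filter fun j =>
    (i : ℕ) * bucketLength n l ≤ (j : ℕ) ∧ (j : ℕ) < ((i : ℕ) + 1) * bucketLength n l

/-- The mean over the `i`-th bucket. -/
def bucketMean {V : Type*} [AddCommGroup V] [Module ℝ V] {n : ℕ} (l : ℕ) (x : Fin n → V)
    (i : Fin l) : V :=
  (bucketLength n l : ℝ)⁻¹ • ∑ j ∈ bucket n l i, x j

/-- The number `𝐄 ‖η̄‖²`, where `η̄ = (η̄_1, …, η̄_ℓ)` is the vector of bucket means of labels. -/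
def expSqNorm {Ω : Type*} [MeasurableSpace Ω] (μ : Measure Ω) {n : ℕ} (l : ℕ)
    (η : Fin n → Ω → ℝ) : ℝ :=
  ∫ ω, ∑ i : Fin l, (bucketMean l (fun j => η j ω) i) ^ 2 ∂μ

/-- The `d × ℓ` matrix whose columns are the bucket means of the data `Y`. -/
def bucketMatrix {n d : ℕ} (l : ℕ) (Y : Fin n → EuclideanSpace ℝ (Fin d)) :
    Matrix (Fin d) (Fin l) ℝ :=
  Matrix.of fun a i => bucketMean l Y i a

/-- `Σ̂ = ℓ⁻¹ Ỹ Ỹᵀ`. -/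
def sampleCov {n d : ℕ} (l : ℕ) (Y : Fin n → EuclideanSpace ℝ (Fin d)) :
    Matrix (Fin d) (Fin d) ℝ :=
  (l : ℝ)⁻¹ • (bucketMatrix l Y * (bucketMatrix l Y).transpose)

/-- The top eigenvalue of a symmetric matrix. -/
def lambdaMax {d : ℕ} (A : Matrix (Fin d) (Fin d) ℝ) : ℝ := sSup (spectrum ℝ A)

/-- `vmax` picks, for every symmetric matrix, a unit eigenvector for its top eigenvalue. -/
def IsTopEigenvectorMap {d : ℕ}
    (vmax : Matrix (Fin d) (Fin d) ℝ → EuclideanSpace ℝ (Fin d)) : Prop :=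
  ∀ A : Matrix (Fin d) (Fin d) ℝ, A.IsSymm →
    ‖vmax A‖ = 1 ∧ A.mulVec (vmax A).ofLp = lambdaMax A • (vmax A).ofLp

/-- The spectral estimator with `ℓ` buckets computed from the data `Y`, where the number `E`
stands for `𝐄 ‖η̄‖²`. -/
def thetaHat {n d : ℕ} (vmax : Matrix (Fin d) (Fin d) ℝ → EuclideanSpace ℝ (Fin d))
    (l : ℕ) (E : ℝ) (Y : Fin n → EuclideanSpace ℝ (Fin d)) : EuclideanSpace ℝ (Fin d) :=
  Real.sqrt ((l : ℝ) / E * max (lambdaMax (sampleCov l Y) - 1 / (bucketLength n l : ℝ)) 0) •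
    vmax (sampleCov l Y)

/-- The number of buckets `ℓ* = d ∨ ⌈n (δ ∨ ‖θ‖²)⌉ ∧ n`. -/
def ellStar (n : ℕ) {d : ℕ} (δ : ℝ) (θ : EuclideanSpace ℝ (Fin d)) : ℕ :=
  max d (min ⌈(n : ℝ) * max δ (‖θ‖ ^ 2)⌉₊ n)

/-- The estimator `θ̂(ℓ*)` evaluated on the observations generated by `θ`. -/
def oracle {Ω : Type*} [MeasurableSpace Ω] (μ : Measure Ω) (δ : ℝ) {n d : ℕ}
    (η : Fin n → Ω → ℝ) (ξ : Fin n → Ω → EuclideanSpace ℝ (Fin d))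
    (vmax : Matrix (Fin d) (Fin d) ℝ → EuclideanSpace ℝ (Fin d))
    (θ : EuclideanSpace ℝ (Fin d)) (ω : Ω) : EuclideanSpace ℝ (Fin d) :=
  thetaHat vmax (ellStar n δ θ) (expSqNorm μ (ellStar n δ θ) η) (obs η ξ θ ω)

/-- The loss `ℓ(a, b) = min (‖a - b‖, ‖a + b‖)`. -/
def loss {d : ℕ} (a b : EuclideanSpace ℝ (Fin d)) : ℝ := min ‖a - b‖ ‖a + b‖

/-- The global rate `√(δ d / n) + d / n`. -/
def globalRate (n d : ℕ) (δ : ℝ) : ℝ := Real.sqrt (δ * d / n) + (d : ℝ) / n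

/-- The three-regime local rate `φ(θ)`; a boundary value of `‖θ‖²` is put in the first regime
that contains it. -/
def localRate (n : ℕ) {d : ℕ} (δ : ℝ) (θ : EuclideanSpace ℝ (Fin d)) : ℝ :=
  if ‖θ‖ ^ 2 ≤ max (Real.sqrt (δ * d / n)) ((d : ℝ) / n) then globalRate n d δ
  else if ‖θ‖ ^ 2 ≤ max δ ((d : ℝ) / n) then (δ * d / n) / ‖θ‖ ^ 2
  else (d : ℝ) / n

/-- Local minimax optimality of `est` with constants `C, c₀, c₁`; `est θ` is the estimator on the
observations generated by `θ`. -/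
def IsLocallyMinimaxOptimal {Ω : Type*} [MeasurableSpace Ω] (μ : Measure Ω) (n : ℕ) {d : ℕ}
    (δ : ℝ) (est : EuclideanSpace ℝ (Fin d) → Ω → EuclideanSpace ℝ (Fin d))
    (C c₀ c₁ : ℝ) : Prop :=
  ⨆ θ : EuclideanSpace ℝ (Fin d), μ {ω | C * localRate n δ θ ≤ loss (est θ ω) θ ^ 2}
    ≤ ENNReal.ofReal (c₁ * Real.exp (-(c₀ * d)))

/-- Global minimax optimality of `est` with constants `C, c₀, c₁`. -/
def IsGloballyMinimaxOptimal {Ω : Type*} [MeasurableSpace Ω] (μ : Measure Ω) (n : ℕ) {d : ℕ}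
    (δ : ℝ) (est : EuclideanSpace ℝ (Fin d) → Ω → EuclideanSpace ℝ (Fin d))
    (C c₀ c₁ : ℝ) : Prop :=
  ⨆ θ : EuclideanSpace ℝ (Fin d), μ {ω | C * globalRate n d δ ≤ loss (est θ ω) θ ^ 2}
    ≤ ENNReal.ofReal (c₁ * Real.exp (-(c₀ * d)))

end MarkovMixture

end

/-!
The bucket means of the data are `η̄ᵢ θ + k^{-1/2} ζᵢ`, where the normalized noise sums `ζᵢ` are
again independent, isotropic and sub-Gaussian. Hence `Σ̂ - k⁻¹ I` differs from `(𝐄 ‖η̄‖² / ℓ) θ θᵀ`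
by three errors: the fluctuation `√(d / ℓ) ‖θ‖²` of the label energy (absent if `k = 1`), the
correlation `√(d / n) ‖θ‖` of labels and noise, and the deviation `k⁻¹ √(d / ℓ)` of the covariance
of the noise from its mean. The last two are controlled on nets of the unit ball. For the first,
the chain has independent increments and `η̄ᵢ²` depends only on the increments within the `i`-th
bucket, so that Hoeffding's inequality applies. The number `ℓ*` of buckets makes `k δ ≤ 1`, so that
a bucket has constant labels with probability at least `1 / e` and `𝐄 ‖η̄‖² ≥ ℓ / e`; it also
balances the three errors. Finally, the top eigenpair of a perturbation of size `ρ` of `θ θᵀ`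
recovers `±θ` with squared error of order `min (ρ, ρ² / ‖θ‖²)`.
-/

noncomputable section

namespace MarkovMixture

section Nets

open Metric Module

variable {E : Type*} [NormedAddCommGroup E] [NormedSpace ℝ E]

lemma packingNumber_closedBall_le [FiniteDimensional ℝ E] :
    packingNumber (1 / 2) (closedBall (0 : E) 1) ≤ (5 ^ finrank ℝ E : ℕ) := by
  refine iSup₂_le fun C hC => iSup_le fun hsep => ?_
  by_contra! hlarge
  obtain ⟨t, htC, ht⟩ := Set.exists_subset_encard_eq (Order.add_one_le_of_lt hlarge)
  have htfin : t.Finite := Set.finite_of_encard_eq_coe (by exact_mod_cast ht)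
  lift t to Finset E using htfin
  classical
  -- Besicovitch's bound is for `1`-separated points of the ball of radius `2`.
  have hcard := Besicovitch.card_le_of_separated (t.image fun x => (2 : ℝ) • x) ?_ ?_
  · rw [Finset.card_image_of_injective _ (smul_right_injective E two_ne_zero)] at hcard
    rw [Set.encard_coe_eq_coe_finsetCard] at ht
    have : t.card = 5 ^ finrank ℝ E + 1 := by exact_mod_cast ht
    lia
  · simp only [Finset.forall_mem_image, norm_smul, Real.norm_ofNat]
    intro x hx
    have := mem_closedBall_zero_iff.1 (hC (htC hx))
    linarith
  · simp only [Finset.forall_mem_image, ← smul_sub, norm_smul, Real.norm_ofNat]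
    intro x hx y hy hxy
    have h : ((1 / 2 : NNReal) : ENNReal) < edist x y :=
      hsep (htC hx) (htC hy) fun h => hxy (congrArg _ h)
    rw [edist_nndist, ENNReal.coe_lt_coe, ← NNReal.coe_lt_coe, coe_nndist, dist_eq_norm] at h
    push_cast at h
    linarith

lemma exists_isCover_closedBall_card_le [FiniteDimensional ℝ E] :
    ∃ s : Finset E, s.card ≤ 5 ^ finrank ℝ E ∧ (s : Set E) ⊆ closedBall 0 1 ∧
      IsCover (1 / 2) (closedBall (0 : E) 1) s := by
  have hle := (coveringNumber_le_packingNumber (1 / 2) (closedBall (0 : E) 1)).trans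
    packingNumber_closedBall_le
  obtain ⟨C, hC, hfin, hcover, hcard⟩ :=
    exists_set_encard_eq_coveringNumber (ne_top_of_le_ne_top (ENat.natCast_ne_top _) hle)
  lift C to Finset E using hfin
  rw [← hcard, Set.encard_coe_eq_coe_finsetCard] at hle
  exact ⟨C, by exact_mod_cast hle, hC, hcover⟩

variable {F : Type*} [SeminormedAddCommGroup F] [NormedSpace ℝ F] {s : Set E}

lemma opNorm_le_two_mul_of_isCover (hs : IsCover (1 / 2) (closedBall (0 : E) 1) s)
    (f : E →L[ℝ] F) {M : ℝ} (hM : ∀ x ∈ s, ‖f x‖ ≤ M) : ‖f‖ ≤ 2 * M := by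
  have hball : ∀ y : E, ‖y‖ ≤ 1 → ‖f y‖ ≤ M + ‖f‖ / 2 := by
    intro y hy
    obtain ⟨x, hx, hyx⟩ := hs (mem_closedBall_zero_iff.2 hy)
    replace hyx : edist y x ≤ ((1 / 2 : NNReal) : ENNReal) := hyx
    rw [edist_nndist, ENNReal.coe_le_coe, ← NNReal.coe_le_coe, coe_nndist, dist_eq_norm,
      NNReal.coe_div, NNReal.coe_one, NNReal.coe_ofNat] at hyx
    calc ‖f y‖ = ‖f x + f (y - x)‖ := by simp
      _ ≤ ‖f x‖ + ‖f (y - x)‖ := norm_add_le _ _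
      _ ≤ M + ‖f‖ * (1 / 2) := add_le_add (hM x hx) (f.le_opNorm_of_le hyx)
      _ = M + ‖f‖ / 2 := by ring
  have hnonneg : 0 ≤ M + ‖f‖ / 2 := (norm_nonneg _).trans (hball 0 (by simp))
  have := ContinuousLinearMap.opNorm_le_of_unit_norm hnonneg fun y hy => hball y hy.le
  linarith

lemma opNorm_bilin_le_four_mul_of_isCover (hs : IsCover (1 / 2) (closedBall (0 : E) 1) s)
    (B : E →L[ℝ] E →L[ℝ] F) {M : ℝ} (hM : ∀ x ∈ s, ∀ y ∈ s, ‖B x y‖ ≤ M) : ‖B‖ ≤ 4 * M := by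
  have := opNorm_le_two_mul_of_isCover hs B fun x hx =>
    opNorm_le_two_mul_of_isCover hs (B x) (hM x hx)
  linarith

end Nets

section Perturbation

lemma loss_smul_sq {d : ℕ} {θ v : EuclideanSpace ℝ (Fin d)} {r : ℝ} (hv : ‖v‖ = 1)
    (hr : 0 ≤ r) :
    loss (r • v) θ ^ 2 = (r - |inner ℝ θ v|) ^ 2 + (‖θ‖ ^ 2 - inner ℝ θ v ^ 2) := by
  set p := inner ℝ θ v with hp
  have hsub : ‖r • v - θ‖ ^ 2 = r ^ 2 - 2 * r * p + ‖θ‖ ^ 2 := by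
    rw [norm_sub_sq_real, norm_smul, hv, inner_smul_left, real_inner_comm, ← hp, mul_one,
      Real.norm_eq_abs, sq_abs, RCLike.conj_to_real, mul_assoc]
  have hadd : ‖r • v + θ‖ ^ 2 = r ^ 2 + 2 * r * p + ‖θ‖ ^ 2 := by
    rw [norm_add_sq_real, norm_smul, hv, inner_smul_left, real_inner_comm, ← hp, mul_one,
      Real.norm_eq_abs, sq_abs, RCLike.conj_to_real, mul_assoc]
  unfold loss
  rcases le_total 0 p with h | h
  · have := mul_nonneg hr h
    rw [min_eq_left (le_of_sq_le_sq (by rw [hsub, hadd]; linarith) (norm_nonneg _)), hsub,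
      abs_of_nonneg h]
    ring
  · have := mul_nonpos_of_nonneg_of_nonpos hr h
    rw [min_eq_right (le_of_sq_le_sq (by rw [hsub, hadd]; linarith) (norm_nonneg _)), hadd,
      abs_of_nonpos h]
    ring

section

variable {E : Type*} [SeminormedAddCommGroup E] [InnerProductSpace ℝ E] {θ v : E} {b e : ℝ}

lemma norm_sq_mul_sub_inner_sq_le (hv : ‖v‖ = 1) (hb : ‖θ‖ ^ 2 / 2 ≤ b)
    (h : ∀ x, inner ℝ θ x = 0 → |b * inner ℝ x v| ≤ e * ‖x‖) :
    ‖θ‖ ^ 2 * (‖θ‖ ^ 2 - inner ℝ θ v ^ 2) ≤ 4 * e ^ 2 := by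
  set p := inner ℝ θ v with hp
  set T := ‖θ‖ ^ 2 with hT
  have hgap : 0 ≤ T - p ^ 2 := by
    have hcs : |p| ≤ ‖θ‖ := by simpa [hv] using abs_real_inner_le_norm θ v
    linarith [sq_le_sq.2 (hcs.trans_eq (abs_norm θ).symm)]
  -- Test the hypothesis on the component of `v` orthogonal to `θ`, scaled by `‖θ‖²`.
  set w := T • v - p • θ with hw
  have hθw : inner ℝ θ w = 0 := by
    rw [hw, inner_sub_right, inner_smul_right, inner_smul_right, real_inner_self_eq_norm_sq,
      ← hp, ← hT, mul_comm, sub_self]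
  have hwv : inner ℝ w v = T - p ^ 2 := by
    rw [hw, inner_sub_left, real_inner_smul_left, real_inner_smul_left,
      real_inner_self_eq_norm_sq, hv, ← hp]
    ring
  have hw_sq : ‖w‖ ^ 2 = T * (T - p ^ 2) := by
    rw [← real_inner_self_eq_norm_sq]
    nth_rewrite 2 [hw]
    rw [inner_sub_right, inner_smul_right, inner_smul_right, hwv, real_inner_comm, hθw]
    ring
  have hbound : T / 2 * (T - p ^ 2) ≤ e * ‖w‖ := by
    have := h w hθw
    rw [hwv] at this
    exact (mul_le_mul_of_nonneg_right hb hgap).trans ((le_abs_self _).trans this)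
  rw [← hw_sq]
  nlinarith [sq_nonneg (‖w‖ - 2 * e)]

end

variable {d : ℕ} {θ v : EuclideanSpace ℝ (Fin d)} {b e : ℝ}

lemma abs_sq_sqrt_sub_inner_sq_le (hv : ‖v‖ = 1)
    (h : ∀ x, |b * inner ℝ x v - inner ℝ θ x * inner ℝ θ v| ≤ e * ‖x‖) :
    |√(max b 0) ^ 2 - inner ℝ θ v ^ 2| ≤ e := by
  have hb : |b - inner ℝ θ v ^ 2| ≤ e := by
    simpa [real_inner_self_eq_norm_sq, hv, ← sq] using h v
  obtain ⟨hl, hu⟩ := abs_le.1 hb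
  have hmax : max b 0 ≤ inner ℝ θ v ^ 2 + e :=
    max_le (by linarith) (by linarith [abs_nonneg (b - inner ℝ θ v ^ 2), sq_nonneg (inner ℝ θ v)])
  rw [Real.sq_sqrt (le_max_right b 0)]
  exact abs_le.2 ⟨by linarith [le_max_left b 0], by linarith⟩

lemma sub_abs_sq_le_abs_sub_sq {r p : ℝ} (hr : 0 ≤ r) : (r - |p|) ^ 2 ≤ |r ^ 2 - p ^ 2| := by
  have hp := abs_nonneg p
  rw [← sq_abs p, sq_sub_sq, abs_mul, abs_of_nonneg (add_nonneg hr hp), ← sq_abs, sq]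
  exact mul_le_mul_of_nonneg_right (abs_le.2 ⟨by linarith, by linarith⟩) (abs_nonneg _)

lemma loss_sq_le_of_perturbation (hv : ‖v‖ = 1)
    (h : ∀ x, |b * inner ℝ x v - inner ℝ θ x * inner ℝ θ v| ≤ e * ‖x‖) (hb : ‖θ‖ ^ 2 - e ≤ b) :
    loss (√(max b 0) • v) θ ^ 2 ≤ 3 * e := by
  have hsq := abs_sq_sqrt_sub_inner_sq_le hv h
  have hgap : ‖θ‖ ^ 2 - inner ℝ θ v ^ 2 ≤ 2 * e := by
    have : |b - inner ℝ θ v ^ 2| ≤ e := by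
      simpa [real_inner_self_eq_norm_sq, hv, ← sq] using h v
    linarith [(abs_le.1 this).2]
  rw [loss_smul_sq hv (Real.sqrt_nonneg _)]
  linarith [sub_abs_sq_le_abs_sub_sq (p := inner ℝ θ v) (Real.sqrt_nonneg (max b 0))]

lemma loss_sq_mul_norm_sq_le_of_perturbation (hv : ‖v‖ = 1)
    (h : ∀ x, |b * inner ℝ x v - inner ℝ θ x * inner ℝ θ v| ≤ e * ‖x‖) (hb : ‖θ‖ ^ 2 - e ≤ b) :
    loss (√(max b 0) • v) θ ^ 2 * ‖θ‖ ^ 2 ≤ 12 * e ^ 2 := by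
  have hloss := loss_sq_le_of_perturbation hv h hb
  rcases le_or_gt (‖θ‖ ^ 2) (4 * e) with hsmall | hlarge
  · nlinarith [mul_le_mul hloss hsmall (sq_nonneg _) ((sq_nonneg _).trans hloss)]
  rw [loss_smul_sq hv (Real.sqrt_nonneg _)]
  have hsq := abs_sq_sqrt_sub_inner_sq_le hv h
  have he : 0 ≤ e := (abs_nonneg _).trans hsq
  have hgap := norm_sq_mul_sub_inner_sq_le (θ := θ) (b := b) (e := e) hv (by linarith)
    fun x hx => by
    have := h x
    rwa [hx, zero_mul, sub_zero] at this
  set r := √(max b 0)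
  set p := inner ℝ θ v
  have hp : ‖θ‖ ^ 2 / 2 ≤ (r + |p|) ^ 2 := by
    have hr : b ≤ r ^ 2 := (le_max_left b 0).trans_eq (Real.sq_sqrt (le_max_right b 0)).symm
    nlinarith [mul_nonneg (Real.sqrt_nonneg (max b 0)) (abs_nonneg p), sq_nonneg |p|]
  have hradial : (r - |p|) ^ 2 * (r + |p|) ^ 2 ≤ e ^ 2 := by
    rw [← mul_pow, mul_comm, ← sq_sub_sq, sq_abs]
    exact sq_le_sq.2 (hsq.trans (le_abs_self e))
  nlinarith [mul_le_mul_of_nonneg_left hp (sq_nonneg (r - |p|))]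

end Perturbation

section SubGaussianSquare

lemma lintegral_exp_mul_sq_gaussianReal {t : ℝ} (ht : t < 1 / 2) :
    ∫⁻ g, ENNReal.ofReal (Real.exp (t * g ^ 2)) ∂gaussianReal 0 1
      = ENNReal.ofReal √(1 - 2 * t)⁻¹ := by
  have hpos : 0 < (1 - 2 * t)⁻¹ := inv_pos.2 (by linarith)
  -- The integrand times the standard density is a multiple of the density of variance `v`.
  lift (1 - 2 * t)⁻¹ to NNReal using hpos.le with v hv
  have hv0 : v ≠ 0 := NNReal.coe_ne_zero.1 hpos.ne'
  have ht' : t = (1 - (v : ℝ)⁻¹) / 2 := by rw [hv, inv_inv]; ring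
  have hpdf : ∀ x : ℝ, gaussianPDFReal 0 1 x * Real.exp (t * x ^ 2)
      = √v * gaussianPDFReal 0 v x := by
    intro x
    have hnorm : (√(2 * Real.pi))⁻¹ = √v * (√(2 * Real.pi * v))⁻¹ := by
      rw [Real.sqrt_mul (by positivity) (v : ℝ)]
      field_simp
    rw [gaussianPDFReal_def, gaussianPDFReal_def, mul_assoc, ← Real.exp_add, NNReal.coe_one,
      mul_one, ← mul_assoc, ← hnorm, ht']
    congr 2
    field_simp
    ring
  rw [gaussianReal_of_var_ne_zero 0 one_ne_zero,
    lintegral_withDensity_eq_lintegral_mul _ (measurable_gaussianPDF 0 1) (by fun_prop)]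
  calc ∫⁻ x, (gaussianPDF 0 1 * fun g => ENNReal.ofReal (Real.exp (t * g ^ 2))) x
      = ∫⁻ x, ENNReal.ofReal √v * ENNReal.ofReal (gaussianPDFReal 0 v x) := by
        refine lintegral_congr fun x => ?_
        rw [Pi.mul_apply, gaussianPDF, ← ENNReal.ofReal_mul (gaussianPDFReal_nonneg _ _ _), hpdf,
          ENNReal.ofReal_mul (Real.sqrt_nonneg _)]
    _ = ENNReal.ofReal √v := by
        rw [lintegral_const_mul _ (by fun_prop), lintegral_gaussianPDFReal_eq_one 0 hv0, mul_one]

lemma lintegral_exp_mul_gaussianReal (x : ℝ) :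
    ∫⁻ g, ENNReal.ofReal (Real.exp (x * g)) ∂gaussianReal 0 1
      = ENNReal.ofReal (Real.exp (x ^ 2 / 2)) := by
  rw [← ofReal_integral_eq_lintegral_ofReal (integrable_exp_mul_gaussianReal _)
    (ae_of_all _ fun _ => (Real.exp_pos _).le)]
  simpa [mgf] using congrArg ENNReal.ofReal
    (congrFun (mgf_fun_id_gaussianReal (μ := 0) (v := 1)) x)

variable {Ω : Type*} [MeasurableSpace Ω] {μ : Measure Ω}

lemma lintegral_exp_mul_le {X : Ω → ℝ} {c : NNReal} (hX : HasSubgaussianMGF X c μ) (t : ℝ) :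
    ∫⁻ ω, ENNReal.ofReal (Real.exp (t * X ω)) ∂μ ≤ ENNReal.ofReal (Real.exp (c * t ^ 2 / 2)) := by
  rw [← ofReal_integral_eq_lintegral_ofReal (hX.integrable_exp_mul _)
    (ae_of_all _ fun _ => (Real.exp_pos _).le)]
  exact ENNReal.ofReal_le_ofReal (hX.mgf_le t)

lemma lintegral_exp_mul_sq_le [SFinite μ] {X : Ω → ℝ} {c : NNReal} {s : ℝ}
    (hX : HasSubgaussianMGF X c μ) (hs : 0 ≤ s) (hcs : 2 * c * s < 1) :
    ∫⁻ ω, ENNReal.ofReal (Real.exp (s * X ω ^ 2)) ∂μ ≤ ENNReal.ofReal √(1 - 2 * c * s)⁻¹ := by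
  -- Linearize the square by an independent standard Gaussian, then integrate it last.
  calc ∫⁻ ω, ENNReal.ofReal (Real.exp (s * X ω ^ 2)) ∂μ
      = ∫⁻ ω, ∫⁻ g, ENNReal.ofReal (Real.exp (√(2 * s) * X ω * g)) ∂gaussianReal 0 1 ∂μ := by
        refine lintegral_congr fun ω => ?_
        rw [lintegral_exp_mul_gaussianReal, mul_pow, Real.sq_sqrt (by positivity)]
        congr 2
        ring
    _ = ∫⁻ g, ∫⁻ ω, ENNReal.ofReal (Real.exp (√(2 * s) * g * X ω)) ∂μ ∂gaussianReal 0 1 := by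
        have := hX.aemeasurable
        rw [lintegral_lintegral_swap (by fun_prop)]
        simp only [mul_right_comm]
    _ ≤ ∫⁻ g, ENNReal.ofReal (Real.exp (c * s * g ^ 2)) ∂gaussianReal 0 1 := by
        refine lintegral_mono fun g => (lintegral_exp_mul_le hX _).trans_eq ?_
        rw [mul_pow, Real.sq_sqrt (by positivity)]
        congr 2
        ring
    _ = ENNReal.ofReal √(1 - 2 * c * s)⁻¹ := by
        rw [lintegral_exp_mul_sq_gaussianReal (by linarith), mul_assoc]

lemma integrable_exp_mul_sq [SFinite μ] {X : Ω → ℝ} {c : NNReal} {s : ℝ}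
    (hX : HasSubgaussianMGF X c μ) (hs : 0 ≤ s) (hcs : 2 * c * s < 1) :
    Integrable (fun ω => Real.exp (s * X ω ^ 2)) μ := by
  have := hX.aemeasurable
  refine ⟨by fun_prop, ?_⟩
  rw [hasFiniteIntegral_iff_ofReal (ae_of_all _ fun _ => (Real.exp_pos _).le)]
  exact (lintegral_exp_mul_sq_le hX hs hcs).trans_lt ENNReal.ofReal_lt_top

lemma integral_exp_mul_sq_le [SFinite μ] {X : Ω → ℝ} {c : NNReal} {s : ℝ}
    (hX : HasSubgaussianMGF X c μ) (hs : 0 ≤ s) (hcs : 2 * c * s < 1) :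
    ∫ ω, Real.exp (s * X ω ^ 2) ∂μ ≤ √(1 - 2 * c * s)⁻¹ := by
  rw [integral_eq_lintegral_of_nonneg_ae (ae_of_all _ fun _ => (Real.exp_pos _).le)
    (integrable_exp_mul_sq hX hs hcs).aestronglyMeasurable]
  exact ENNReal.toReal_le_of_le_ofReal (Real.sqrt_nonneg _) (lintegral_exp_mul_sq_le hX hs hcs)

variable {X : Ω → ℝ}

lemma integral_exp_sq_div_eight_le [SFinite μ] (hX : HasSubgaussianMGF X 1 μ) :
    ∫ ω, Real.exp (1 / 8 * X ω ^ 2) ∂μ ≤ 5 / 4 := by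
  refine (integral_exp_mul_sq_le hX (by norm_num) (by norm_num)).trans ?_
  rw [Real.sqrt_le_left (by norm_num)]
  norm_num

variable [IsProbabilityMeasure μ]

lemma integral_sq_le_two (hX : HasSubgaussianMGF X 1 μ) : ∫ ω, X ω ^ 2 ∂μ ≤ 2 := by
  have hsq : Integrable (fun ω => X ω ^ 2) μ := (hX.memLp 2).integrable_sq
  have hexp : Integrable (fun ω => Real.exp (1 / 8 * X ω ^ 2)) μ :=
    integrable_exp_mul_sq hX (by norm_num) (by norm_num)
  have hmono : ∫ ω, (1 / 8 * X ω ^ 2 + 1) ∂μ ≤ 5 / 4 :=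
    (integral_mono ((hsq.const_mul _).add (integrable_const 1)) hexp
      fun ω => Real.add_one_le_exp _).trans (integral_exp_sq_div_eight_le hX)
  rw [integral_add (hsq.const_mul _) (integrable_const 1), integral_const_mul] at hmono
  simp only [integral_const, probReal_univ, smul_eq_mul] at hmono
  linarith

lemma exp_le_one_add_add_sq_mul_exp_abs (x : ℝ) :
    Real.exp x ≤ 1 + x + x ^ 2 * Real.exp |x| := by
  have h := Complex.norm_exp_sub_sum_le_norm_mul_exp (x : ℂ) 2
  have hsum : Complex.exp (x : ℂ) - ∑ m ∈ Finset.range 2, (x : ℂ) ^ m / (m.factorial : ℂ)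
      = ((Real.exp x - (1 + x) : ℝ) : ℂ) := by
    simp [Finset.sum_range_succ]
  rw [hsum, Complex.norm_real, Complex.norm_real, Real.norm_eq_abs, Real.norm_eq_abs, sq_abs] at h
  linarith [le_abs_self (Real.exp x - (1 + x))]

lemma exp_mul_sq_sub_le {s m x : ℝ} (hs : |s| ≤ 1 / 16) (hm0 : 0 ≤ m) (hm2 : m ≤ 2) :
    Real.exp (s * (x ^ 2 - m)) ≤ 1 + s * (x ^ 2 - m) + 1024 * s ^ 2 * Real.exp (1 / 8 * x ^ 2) := by
  set y := x ^ 2 - m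
  have hyabs : |y| ≤ x ^ 2 + 2 := abs_le.2 ⟨by nlinarith [sq_nonneg x], by linarith⟩
  have hsy : |s * y| ≤ |y| / 16 := by
    rw [abs_mul]
    nlinarith [abs_nonneg y]
  have hquad : y ^ 2 ≤ 512 * Real.exp (|y| / 16) := by
    have := Real.quadratic_le_exp_of_nonneg (x := |y| / 16) (by positivity)
    nlinarith [sq_abs y, abs_nonneg y]
  have hexp : Real.exp (|y| / 16) * Real.exp |s * y| ≤ 2 * Real.exp (1 / 8 * x ^ 2) := by
    have hquarter : Real.exp (1 / 4) ≤ 2 :=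
      (Real.exp_bound_div_one_sub_of_interval (by norm_num) (by norm_num)).trans (by norm_num)
    calc Real.exp (|y| / 16) * Real.exp |s * y| = Real.exp (|y| / 16 + |s * y|) :=
          (Real.exp_add _ _).symm
      _ ≤ Real.exp (1 / 4 + 1 / 8 * x ^ 2) := Real.exp_le_exp.2 (by linarith)
      _ ≤ 2 * Real.exp (1 / 8 * x ^ 2) := by rw [Real.exp_add]; gcongr
  have hrem : (s * y) ^ 2 * Real.exp |s * y| ≤ 1024 * s ^ 2 * Real.exp (1 / 8 * x ^ 2) := by
    calc (s * y) ^ 2 * Real.exp |s * y| = s ^ 2 * (y ^ 2 * Real.exp |s * y|) := by ring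
      _ ≤ s ^ 2 * (512 * Real.exp (|y| / 16) * Real.exp |s * y|) := by gcongr
      _ = 512 * s ^ 2 * (Real.exp (|y| / 16) * Real.exp |s * y|) := by ring
      _ ≤ 512 * s ^ 2 * (2 * Real.exp (1 / 8 * x ^ 2)) := by gcongr
      _ = 1024 * s ^ 2 * Real.exp (1 / 8 * x ^ 2) := by ring
  linarith [exp_le_one_add_add_sq_mul_exp_abs (s * y)]

lemma integrable_exp_mul_sq_sub_integral {s : ℝ} (hX : HasSubgaussianMGF X 1 μ)
    (hs : |s| ≤ 1 / 16) : Integrable (fun ω => Real.exp (s * (X ω ^ 2 - ∫ ω, X ω ^ 2 ∂μ))) μ := by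
  have hsq : Integrable (fun ω => X ω ^ 2) μ := (hX.memLp 2).integrable_sq
  have hexp : Integrable (fun ω => Real.exp (1 / 8 * X ω ^ 2)) μ :=
    integrable_exp_mul_sq hX (by norm_num) (by norm_num)
  have := hX.aemeasurable
  have hlin := (hsq.sub (integrable_const (∫ ω, X ω ^ 2 ∂μ))).const_mul s
  refine (((integrable_const 1).add hlin).add (hexp.const_mul (1024 * s ^ 2))).mono' (by fun_prop)
    (ae_of_all _ fun ω => ?_)
  rw [Real.norm_eq_abs, Real.abs_exp]
  exact exp_mul_sq_sub_le hs (integral_nonneg fun _ => sq_nonneg _) (integral_sq_le_two hX)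

lemma mgf_sq_sub_integral_le {s : ℝ} (hX : HasSubgaussianMGF X 1 μ) (hs : |s| ≤ 1 / 16) :
    mgf (fun ω => X ω ^ 2 - ∫ ω, X ω ^ 2 ∂μ) μ s ≤ Real.exp (2048 * s ^ 2) := by
  set m := ∫ ω, X ω ^ 2 ∂μ with hm
  have hsq : Integrable (fun ω => X ω ^ 2) μ := (hX.memLp 2).integrable_sq
  have hlin : Integrable (fun ω => s * (X ω ^ 2 - m)) μ :=
    (hsq.sub (integrable_const m)).const_mul s
  have haff : Integrable (fun ω => 1 + s * (X ω ^ 2 - m)) μ := (integrable_const 1).add hlin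
  have hrem : Integrable (fun ω => 1024 * s ^ 2 * Real.exp (1 / 8 * X ω ^ 2)) μ :=
    (integrable_exp_mul_sq hX (by norm_num) (by norm_num)).const_mul _
  calc mgf (fun ω => X ω ^ 2 - m) μ s
      ≤ ∫ ω, (1 + s * (X ω ^ 2 - m) + 1024 * s ^ 2 * Real.exp (1 / 8 * X ω ^ 2)) ∂μ :=
        integral_mono (integrable_exp_mul_sq_sub_integral hX hs) (haff.add hrem) fun ω =>
          exp_mul_sq_sub_le hs (integral_nonneg fun _ => sq_nonneg _) (integral_sq_le_two hX)
    _ = 1 + 1024 * s ^ 2 * ∫ ω, Real.exp (1 / 8 * X ω ^ 2) ∂μ := by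
        rw [integral_add haff hrem, integral_const_mul, integral_add (integrable_const 1) hlin,
          integral_const_mul, integral_sub hsq (integrable_const m), ← hm]
        simp
    _ ≤ 1 + 1024 * s ^ 2 * (5 / 4) := by gcongr; exact integral_exp_sq_div_eight_le hX
    _ ≤ Real.exp (2048 * s ^ 2) := by nlinarith [Real.add_one_le_exp (2048 * s ^ 2), sq_nonneg s]

end SubGaussianSquare

section Bernstein

variable {Ω ι : Type*} [MeasurableSpace Ω] {μ : Measure Ω} [Fintype ι]

lemma measureReal_abs_ge_le_of_mgf_le [IsFiniteMeasure μ] {Y : Ω → ℝ} {s ε M : ℝ} (hs : 0 ≤ s)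
    (hpos : Integrable (fun ω => Real.exp (s * Y ω)) μ)
    (hneg : Integrable (fun ω => Real.exp (-s * Y ω)) μ) (hM : mgf Y μ s ≤ M)
    (hM' : mgf Y μ (-s) ≤ M) :
    μ.real {ω | ε ≤ |Y ω|} ≤ 2 * (Real.exp (-s * ε) * M) := by
  have hupper : μ.real {ω | ε ≤ Y ω} ≤ Real.exp (-s * ε) * M :=
    (measure_ge_le_exp_mul_mgf ε hs hpos).trans (by gcongr)
  have hlower : μ.real {ω | Y ω ≤ -ε} ≤ Real.exp (-s * ε) * M := by
    refine (measure_le_le_exp_mul_mgf (-ε) (neg_nonpos.2 hs) hneg).trans ?_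
    rw [neg_neg, mul_neg, neg_mul]
    gcongr
  have hsub : {ω | ε ≤ |Y ω|} ⊆ {ω | ε ≤ Y ω} ∪ {ω | Y ω ≤ -ε} := fun ω (hω : ε ≤ |Y ω|) =>
    (le_abs.1 hω).imp id (fun h => le_neg.1 h)
  linarith [measureReal_mono (μ := μ) hsub,
    measureReal_union_le (μ := μ) {ω | ε ≤ Y ω} {ω | Y ω ≤ -ε}]

lemma measureReal_abs_sum_sq_sub_integral_ge_le {X : ι → Ω → ℝ} {s ε : ℝ} (hind : iIndepFun X μ)
    (hmeas : ∀ i, Measurable (X i)) (hX : ∀ i, HasSubgaussianMGF (X i) 1 μ) (hs0 : 0 ≤ s)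
    (hs : s ≤ 1 / 16) :
    μ.real {ω | ε ≤ |∑ i, (X i ω ^ 2 - ∫ ω, X i ω ^ 2 ∂μ)|}
      ≤ 2 * Real.exp (-s * ε + 2048 * s ^ 2 * Fintype.card ι) := by
  have := hind.isProbabilityMeasure
  set Y : ι → Ω → ℝ := fun i ω => X i ω ^ 2 - ∫ ω, X i ω ^ 2 ∂μ
  have hYind : iIndepFun Y μ :=
    hind.comp (fun i x => x ^ 2 - ∫ ω, X i ω ^ 2 ∂μ) fun _ => by fun_prop
  have hYm : ∀ i, Measurable (Y i) := fun i => by fun_prop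
  have hint : ∀ t, |t| ≤ 1 / 16 → Integrable (fun ω => Real.exp (t * (∑ i, Y i) ω)) μ :=
    fun t ht => hYind.integrable_exp_mul_sum hYm fun i _ =>
      integrable_exp_mul_sq_sub_integral (hX i) ht
  have hmgf : ∀ t, |t| ≤ 1 / 16 →
      mgf (∑ i, Y i) μ t ≤ Real.exp (2048 * t ^ 2 * Fintype.card ι) := by
    intro t ht
    rw [hYind.mgf_sum hYm, mul_comm, Real.exp_nat_mul, ← Finset.card_univ]
    exact (Finset.prod_le_prod (fun i _ => mgf_nonneg) fun i _ =>
      mgf_sq_sub_integral_le (hX i) ht).trans_eq (Finset.prod_const _)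
  have habs : |s| ≤ 1 / 16 := by rwa [abs_of_nonneg hs0]
  have hneg : |-s| ≤ 1 / 16 := by rwa [abs_neg]
  rw [Real.exp_add]
  simpa only [Finset.sum_apply] using measureReal_abs_ge_le_of_mgf_le (ε := ε) hs0 (hint s habs)
    (hint (-s) hneg) (hmgf s habs) (by simpa only [neg_sq] using hmgf (-s) hneg)

end Bernstein

section IndependentGroups

variable {Ω : Type*} [MeasurableSpace Ω] {μ : Measure Ω}

lemma measureReal_exists_mem_le {α : Type*} {s : Finset α} {p : α → Ω → Prop} {b : ℝ}
    (h : ∀ x ∈ s, μ.real {ω | p x ω} ≤ b) :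
    μ.real {ω | ∃ x ∈ s, p x ω} ≤ s.card * b := by
  have hset : {ω | ∃ x ∈ s, p x ω} = ⋃ x ∈ s, {ω | p x ω} := by ext; simp
  rw [hset, ← nsmul_eq_mul]
  exact (measureReal_biUnion_finset_le _ _).trans (Finset.sum_le_card_nsmul s _ b h)

lemma measure_prodMk_mem_le_of_indepFun [IsFiniteMeasure μ] {α β : Type*} [MeasurableSpace α]
    [MeasurableSpace β] {X : Ω → α} {Y : Ω → β} (hX : Measurable X) (hY : Measurable Y)
    (hXY : IndepFun X Y μ) {S : Set (α × β)} (hS : MeasurableSet S) {b : ENNReal}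
    (hb : ∀ᵐ ω ∂μ, μ {ω' | (X ω, Y ω') ∈ S} ≤ b) :
    μ {ω | (X ω, Y ω) ∈ S} ≤ b * μ Set.univ := by
  calc μ {ω | (X ω, Y ω) ∈ S} = ((μ.map X).prod (μ.map Y)) S := by
        rw [← hXY.map_prod_eq_prod_map_map hX.aemeasurable hY.aemeasurable,
          Measure.map_apply (hX.prodMk hY) hS]
        rfl
    _ = ∫⁻ ω, μ {ω' | (X ω, Y ω') ∈ S} ∂μ := by
        rw [Measure.prod_apply hS, lintegral_map (measurable_measure_prodMk_left hS) hX]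
        exact lintegral_congr fun ω => Measure.map_apply hY (measurable_prodMk_left hS)
    _ ≤ ∫⁻ _, b ∂μ := lintegral_mono_ae hb
    _ = b * μ Set.univ := lintegral_const b

lemma iIndepFun_comp_of_pairwise_disjoint {ι κ β γ : Type*} [MeasurableSpace β]
    [MeasurableSpace γ] {f : ι → Ω → β} (hf : iIndepFun f μ) (hm : ∀ i, Measurable (f i))
    {S : κ → Finset ι} (hS : Pairwise (Function.onFun Disjoint S)) {g : ∀ i, (S i → β) → γ}
    (hg : ∀ i, Measurable (g i)) : iIndepFun (fun i ω => g i fun j => f j ω) μ := by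
  classical
  have := hf.isProbabilityMeasure
  rw [iIndepFun_iff_measure_inter_preimage_eq_mul]
  intro T B hB
  induction T using Finset.induction_on with
  | empty => simp
  | insert i T hi ih =>
    rw [Finset.prod_insert hi, Finset.set_biInter_insert,
      ← ih fun j hj => hB j (Finset.mem_insert_of_mem hj)]
    have hdisj : Disjoint (S i) (T.biUnion S) := by
      refine (Finset.disjoint_biUnion_right _ _ _).2 fun j hj => hS ?_
      rintro rfl
      exact hi hj
    let restrict (j : T) (x : T.biUnion S → β) : S j → β :=
      fun a => x ⟨a, Finset.mem_biUnion.2 ⟨j, j.2, a.2⟩⟩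
    have hrestrict : ∀ j, Measurable (restrict j) := fun j =>
      measurable_pi_lambda _ fun a => measurable_pi_apply _
    have hinter : (⋂ j ∈ T, (fun ω => g j fun a => f a ω) ⁻¹' B j)
        = (fun ω (a : T.biUnion S) => f a ω) ⁻¹'
          ⋂ j : T, (fun x => g j (restrict j x)) ⁻¹' B j := by
      ext ω
      simp [restrict]
    rw [hinter]
    exact (indepFun_iff_measure_inter_preimage_eq_mul.1
      (hf.indepFun_finset (S i) (T.biUnion S) hdisj hm)) _ _
      (hg i (hB i (Finset.mem_insert_self _ _)))
      (MeasurableSet.iInter fun j =>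
        ((hg j).comp (hrestrict j)) (hB j (Finset.mem_insert_of_mem j.2)))

end IndependentGroups

section SubGaussianVariables

variable {Ω : Type*} [MeasurableSpace Ω] {μ : Measure Ω} {X : Ω → ℝ} {c : NNReal}

lemma hasSubgaussianMGF_mono {c' : NNReal} (hX : HasSubgaussianMGF X c μ) (hc : c ≤ c') :
    HasSubgaussianMGF X c' μ where
  integrable_exp_mul := hX.integrable_exp_mul
  mgf_le t := (hX.mgf_le t).trans (Real.exp_le_exp.2 (by gcongr))

lemma measureReal_abs_gt_le_of_hasSubgaussianMGF [IsFiniteMeasure μ]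
    (hX : HasSubgaussianMGF X c μ) {ε : ℝ} (hε : 0 ≤ ε) :
    μ.real {ω | ε < |X ω|} ≤ 2 * Real.exp (-ε ^ 2 / (2 * c)) := by
  have hsub : {ω | ε < |X ω|} ⊆ {ω | ε ≤ X ω} ∪ {ω | ε ≤ (-X) ω} :=
    fun ω (hω : ε < |X ω|) => (lt_abs.1 hω).imp le_of_lt le_of_lt
  linarith [hX.measure_ge_le hε, hX.neg.measure_ge_le hε, measureReal_mono (μ := μ) hsub,
    measureReal_union_le (μ := μ) {ω | ε ≤ X ω} {ω | ε ≤ (-X) ω}]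

-- `exp (c t² / 2) - mgf X μ t` is nonnegative and vanishes at `0`, where its derivative is `-𝐄 X`.
lemma integral_eq_zero_of_hasSubgaussianMGF [IsProbabilityMeasure μ]
    (hX : HasSubgaussianMGF X c μ) : ∫ ω, X ω ∂μ = 0 := by
  have hmgf : HasDerivAt (mgf X μ) (∫ ω, X ω ∂μ) 0 := by
    simpa using hasDerivAt_mgf (X := X) (μ := μ) (t := 0) (by simp [hX.integrableExpSet_eq_univ])
  have hexp : HasDerivAt (fun t : ℝ => Real.exp (c * t ^ 2 / 2)) 0 0 := by
    simpa using (((hasDerivAt_pow 2 (0 : ℝ)).const_mul (c : ℝ)).div_const 2).exp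
  have hmin : IsLocalMin ((fun t : ℝ => Real.exp (c * t ^ 2 / 2)) - mgf X μ) 0 :=
    Filter.Eventually.of_forall fun t => by simpa using hX.mgf_le t
  simpa using hmin.hasDerivAt_eq_zero (hexp.sub hmgf)

end SubGaussianVariables

section IsIndepSubGaussian

/-- Independent isotropic `1`-sub-Gaussian random vectors `ζ i`; they need not have the same
law. -/
structure IsIndepSubGaussian {Ω ι E : Type*} [MeasurableSpace Ω] [NormedAddCommGroup E]
    [InnerProductSpace ℝ E] [MeasurableSpace E] (μ : Measure Ω) (ζ : ι → Ω → E) : Prop where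
  measurable : ∀ i, Measurable (ζ i)
  indep : iIndepFun ζ μ
  isotropic : ∀ i v, ∫ ω, inner ℝ v (ζ i ω) ^ 2 ∂μ = ‖v‖ ^ 2
  subGaussian : ∀ i v, HasSubgaussianMGF (fun ω => inner ℝ v (ζ i ω)) (‖v‖₊ ^ 2) μ

lemma IsSubGaussianNoise.isIndepSubGaussian {Ω : Type*} [MeasurableSpace Ω] {μ : Measure Ω}
    {n d : ℕ} {ξ : Fin n → Ω → EuclideanSpace ℝ (Fin d)} (h : IsSubGaussianNoise μ ξ) :
    IsIndepSubGaussian μ ξ where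
  measurable := h.measurable
  indep := h.indep
  isotropic := h.isotropic
  subGaussian i v :=
    { integrable_exp_mul := fun t => by
        simpa only [inner_smul_left, conj_trivial] using (h.subGaussian i (t • v)).1
      mgf_le := fun t => by
        have := (h.subGaussian i (t • v)).2
        simp only [inner_smul_left, conj_trivial, norm_smul, mul_pow, Real.norm_eq_abs,
          sq_abs] at this
        rwa [mul_comm (t ^ 2)] at this }

/-- The sum of the `z j`, `j ∈ S`, divided by `√#S`, so that independent isotropic vectors stay
isotropic. -/
def normalizedSum {ι V : Type*} [AddCommGroup V] [Module ℝ V] (S : Finset ι) (z : ι → V) : V :=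
  (√(S.card : ℝ))⁻¹ • ∑ j ∈ S, z j

/-- The deviation of the empirical covariance of the vectors `z i` from the identity, as the
bilinear form `(x, y) ↦ (#ι)⁻¹ ∑ i, ⟪z i, x⟫ ⟪z i, y⟫ - ⟪x, y⟫`. -/
def covDeviation {ι E : Type*} [Fintype ι] [NormedAddCommGroup E] [InnerProductSpace ℝ E]
    (z : ι → E) : E →L[ℝ] E →L[ℝ] ℝ :=
  (Fintype.card ι : ℝ)⁻¹ • ∑ i, (innerSL ℝ (z i)).smulRight (innerSL ℝ (z i))
    - (isBoundedBilinearMap_inner (𝕜 := ℝ) (E := E)).toContinuousLinearMap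

section Deterministic

variable {ι E : Type*} [NormedAddCommGroup E] [InnerProductSpace ℝ E]

lemma inner_normalizedSum (S : Finset ι) (v : E) (z : ι → E) :
    inner ℝ v (normalizedSum S z) = normalizedSum S fun j => inner ℝ v (z j) := by
  rw [normalizedSum, inner_smul_right, inner_sum, normalizedSum, smul_eq_mul]

variable [Fintype ι]

lemma covDeviation_apply (z : ι → E) (x y : E) :
    covDeviation z x y
      = (Fintype.card ι : ℝ)⁻¹ * ∑ i, inner ℝ (z i) x * inner ℝ (z i) y - inner ℝ x y := by
  simp [covDeviation, IsBoundedBilinearMap.toContinuousLinearMap_apply]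

lemma covDeviation_polarization (z : ι → E) (x y : E) :
    covDeviation z x y
      = covDeviation z ((1 / 2 : ℝ) • (x + y)) ((1 / 2 : ℝ) • (x + y))
        - covDeviation z ((1 / 2 : ℝ) • (x - y)) ((1 / 2 : ℝ) • (x - y)) := by
  have hcomm : covDeviation z y x = covDeviation z x y := by
    simp only [covDeviation_apply, real_inner_comm x y, mul_comm]
  simp only [map_smul, map_add, map_sub, smul_apply, add_apply, sub_apply,
    smul_eq_mul, hcomm]
  ring

end Deterministic

variable {Ω ι E : Type*} [MeasurableSpace Ω] {μ : Measure Ω} [NormedAddCommGroup E]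
  [InnerProductSpace ℝ E] [MeasurableSpace E] {ζ : ι → Ω → E}

namespace IsIndepSubGaussian

lemma subGaussian_one (h : IsIndepSubGaussian μ ζ) (i : ι) {v : E} (hv : ‖v‖ ≤ 1) :
    HasSubgaussianMGF (fun ω => inner ℝ v (ζ i ω)) 1 μ :=
  hasSubgaussianMGF_mono (h.subGaussian i v) (pow_le_one₀ zero_le hv)

variable [BorelSpace E] [FiniteDimensional ℝ E]

lemma measurable_inner (h : IsIndepSubGaussian μ ζ) (v : E) (i : ι) :
    Measurable fun ω => inner ℝ v (ζ i ω) :=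
  measurable_const.inner (h.measurable i)

lemma iIndepFun_inner (h : IsIndepSubGaussian μ ζ) (v : E) :
    iIndepFun (fun i ω => inner ℝ v (ζ i ω)) μ :=
  h.indep.comp (fun _ x => inner ℝ v x) fun _ => measurable_const.inner measurable_id

lemma integral_normalizedSum_inner_sq (h : IsIndepSubGaussian μ ζ) {S : Finset ι}
    (hS : S.Nonempty) (v : E) :
    ∫ ω, normalizedSum S (fun j => inner ℝ v (ζ j ω)) ^ 2 ∂μ = ‖v‖ ^ 2 := by
  have := h.indep.isProbabilityMeasure
  have hcentred : ∀ j, ∫ ω, inner ℝ v (ζ j ω) ∂μ = 0 := fun j =>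
    integral_eq_zero_of_hasSubgaussianMGF (h.subGaussian j v)
  have hvar : ∫ ω, (∑ j ∈ S, inner ℝ v (ζ j ω)) ^ 2 ∂μ = S.card * ‖v‖ ^ 2 := by
    have hsum := IndepFun.variance_sum (μ := μ) (s := S) (X := fun j ω => inner ℝ v (ζ j ω))
      (fun j _ => (h.subGaussian j v).memLp 2)
      fun j _ j' _ hj => (h.iIndepFun_inner v).indepFun hj
    have hzero : ∫ ω, (∑ j ∈ S, fun ω => inner ℝ v (ζ j ω)) ω ∂μ = 0 := by
      simp only [Finset.sum_apply]
      rw [integral_finsetSum _ fun j _ => (h.subGaussian j v).integrable]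
      exact Finset.sum_eq_zero fun j _ => hcentred j
    rw [variance_of_integral_eq_zero
      (Finset.aemeasurable_sum _ fun j _ => (h.measurable_inner v j).aemeasurable) hzero] at hsum
    simp only [Finset.sum_apply, h.isotropic, nsmul_eq_mul, Finset.sum_const,
      variance_of_integral_eq_zero (h.measurable_inner v _).aemeasurable (hcentred _)] at hsum
    exact hsum
  have hcard : (S.card : ℝ) ≠ 0 := by exact_mod_cast hS.card_pos.ne'
  simp only [normalizedSum, smul_eq_mul, mul_pow, inv_pow, Real.sq_sqrt (Nat.cast_nonneg _)]
  rw [integral_const_mul, hvar, inv_mul_cancel_left₀ hcard]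

lemma hasSubgaussianMGF_normalizedSum_inner (h : IsIndepSubGaussian μ ζ) {S : Finset ι}
    (hS : S.Nonempty) (v : E) :
    HasSubgaussianMGF (fun ω => normalizedSum S fun j => inner ℝ v (ζ j ω)) (‖v‖₊ ^ 2) μ := by
  have hsum := (HasSubgaussianMGF.sum_of_iIndepFun (h.iIndepFun_inner v) (s := S)
    (c := fun _ => ‖v‖₊ ^ 2) fun j _ => h.subGaussian j v).const_mul (√(S.card : ℝ))⁻¹
  refine hasSubgaussianMGF_mono hsum (le_of_eq (NNReal.eq ?_))
  have hcard : (S.card : ℝ) ≠ 0 := by exact_mod_cast hS.card_pos.ne'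
  change (√(S.card : ℝ))⁻¹ ^ 2 * ((∑ _j ∈ S, ‖v‖₊ ^ 2 : NNReal) : ℝ) = ‖v‖ ^ 2
  rw [Finset.sum_const, inv_pow, Real.sq_sqrt (Nat.cast_nonneg _), nsmul_eq_mul]
  push_cast
  rw [inv_mul_cancel_left₀ hcard]

lemma normalizedSum_of_pairwise_disjoint {κ : Type*} {S : κ → Finset ι} (h : IsIndepSubGaussian μ ζ)
    (hS : ∀ i, (S i).Nonempty) (hdisj : Pairwise (Function.onFun Disjoint S)) :
    IsIndepSubGaussian μ fun i ω => normalizedSum (S i) fun j => ζ j ω where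
  measurable i := (Finset.measurable_sum _ fun j _ => h.measurable j).const_smul _
  indep := by
    have hgroup := iIndepFun_comp_of_pairwise_disjoint h.indep h.measurable hdisj
      (g := fun i z => (√((S i).card : ℝ))⁻¹ • ∑ j, z j) fun i => by fun_prop
    convert hgroup using 3
    rw [normalizedSum, ← Finset.sum_coe_sort]
  isotropic i v := by
    simp only [inner_normalizedSum]
    exact h.integral_normalizedSum_inner_sq (hS i) v
  subGaussian i v := by
    simp only [inner_normalizedSum]
    exact h.hasSubgaussianMGF_normalizedSum_inner (hS i) v

end IsIndepSubGaussian

end IsIndepSubGaussian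

section NoiseConcentration

open Module

lemma five_pow_le_exp (d : ℕ) : (5 : ℝ) ^ d ≤ Real.exp (2 * d) := by
  rw [mul_comm, Real.exp_nat_mul]
  gcongr
  calc (5 : ℝ) ≤ 2.7 ^ 2 := by norm_num
    _ ≤ Real.exp 1 ^ 2 := by gcongr; linarith [Real.exp_one_gt_d9]
    _ = Real.exp 2 := by rw [← Real.exp_nat_mul]; norm_num

variable {Ω ι E : Type*} [MeasurableSpace Ω] {μ : Measure Ω} [Fintype ι] [NormedAddCommGroup E]
  [InnerProductSpace ℝ E] [MeasurableSpace E] [BorelSpace E] [FiniteDimensional ℝ E] {ζ : ι → Ω → E}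

namespace IsIndepSubGaussian

lemma hasSubgaussianMGF_inner_sum_smul (h : IsIndepSubGaussian μ ζ) {a : ι → ℝ}
    (ha : ∀ i, |a i| ≤ 1) {x : E} (hx : ‖x‖ ≤ 1) :
    HasSubgaussianMGF (fun ω => inner ℝ x (∑ i, a i • ζ i ω)) (Fintype.card ι) μ := by
  have hind : iIndepFun (fun i ω => a i * inner ℝ x (ζ i ω)) μ :=
    (h.iIndepFun_inner x).comp (fun i y => a i * y) fun i => measurable_const_mul (a i)
  have hsum := HasSubgaussianMGF.sum_of_iIndepFun hind (s := Finset.univ) (c := fun _ => 1)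
    fun i _ => hasSubgaussianMGF_mono ((h.subGaussian_one i hx).const_mul (a i)) (by
      change a i ^ 2 * 1 ≤ (1 : ℝ)
      rw [mul_one]
      exact (sq_le_one_iff_abs_le_one _).2 (ha i))
  simpa [inner_sum, inner_smul_right] using hsum

variable [Nonempty ι]

lemma measureReal_abs_covDeviation_self_gt_le (h : IsIndepSubGaussian μ ζ) {v : E} (hv : ‖v‖ ≤ 1)
    {r : ℝ} (hr0 : 0 ≤ r) (hr1 : r ≤ 1) :
    μ.real {ω | 208 * r < |covDeviation (fun i => ζ i ω) v v|}
      ≤ 2 * Real.exp (-(5 * r ^ 2 * Fintype.card ι)) := by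
  have := h.indep.isProbabilityMeasure
  have hcard : (0 : ℝ) < Fintype.card ι := by exact_mod_cast Fintype.card_pos
  have hdev : ∀ ω, ∑ i, (inner ℝ v (ζ i ω) ^ 2 - ∫ ω, inner ℝ v (ζ i ω) ^ 2 ∂μ)
      = Fintype.card ι * covDeviation (fun i => ζ i ω) v v := fun ω => by
    simp only [covDeviation_apply, h.isotropic, Finset.sum_sub_distrib, Finset.sum_const,
      Finset.card_univ, nsmul_eq_mul, real_inner_self_eq_norm_sq, real_inner_comm v, ← sq]
    field_simp
  have hbernstein := measureReal_abs_sum_sq_sub_integral_ge_le (s := r / 16)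
    (ε := 208 * Fintype.card ι * r) (h.iIndepFun_inner v) (h.measurable_inner v)
    (fun i => h.subGaussian_one i hv) (by positivity) (by linarith)
  have hexponent : -(r / 16) * (208 * Fintype.card ι * r) + 2048 * (r / 16) ^ 2 * Fintype.card ι
      = -(5 * r ^ 2 * Fintype.card ι) := by ring
  rw [hexponent] at hbernstein
  refine (measureReal_mono fun ω hω => ?_).trans hbernstein
  rw [Set.mem_ofPred_eq] at hω ⊢
  rw [hdev, abs_mul, abs_of_pos hcard]
  nlinarith

lemma measureReal_abs_covDeviation_gt_le (h : IsIndepSubGaussian μ ζ) {x y : E} (hx : ‖x‖ ≤ 1)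
    (hy : ‖y‖ ≤ 1) {r : ℝ} (hr0 : 0 ≤ r) (hr1 : r ≤ 1) :
    μ.real {ω | 416 * r < |covDeviation (fun i => ζ i ω) x y|}
      ≤ 4 * Real.exp (-(5 * r ^ 2 * Fintype.card ι)) := by
  have := h.indep.isProbabilityMeasure
  have hadd : ‖(1 / 2 : ℝ) • (x + y)‖ ≤ 1 := by
    rw [norm_smul]; norm_num; linarith [norm_add_le x y]
  have hsub : ‖(1 / 2 : ℝ) • (x - y)‖ ≤ 1 := by
    rw [norm_smul]; norm_num; linarith [norm_sub_le x y]
  set p := (1 / 2 : ℝ) • (x + y)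
  set m := (1 / 2 : ℝ) • (x - y)
  have hunion : {ω | 416 * r < |covDeviation (fun i => ζ i ω) x y|}
      ⊆ {ω | 208 * r < |covDeviation (fun i => ζ i ω) p p|}
        ∪ {ω | 208 * r < |covDeviation (fun i => ζ i ω) m m|} := fun ω hω => by
    by_contra hle
    simp only [Set.mem_union, Set.mem_ofPred_eq, not_or, not_lt] at hle hω
    rw [covDeviation_polarization] at hω
    linarith [abs_sub (covDeviation (fun i => ζ i ω) p p) (covDeviation (fun i => ζ i ω) m m)]
  linarith [measureReal_mono (μ := μ) hunion, measureReal_union_le (μ := μ)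
    {ω | 208 * r < |covDeviation (fun i => ζ i ω) p p|}
    {ω | 208 * r < |covDeviation (fun i => ζ i ω) m m|},
    h.measureReal_abs_covDeviation_self_gt_le hadd hr0 hr1,
    h.measureReal_abs_covDeviation_self_gt_le hsub hr0 hr1]

lemma measureReal_norm_covDeviation_gt_le (h : IsIndepSubGaussian μ ζ)
    (hd : finrank ℝ E ≤ Fintype.card ι) :
    μ.real {ω | 1664 * √(finrank ℝ E / Fintype.card ι) < ‖covDeviation fun i => ζ i ω‖}
      ≤ 4 * Real.exp (-finrank ℝ E) := by
  have := h.indep.isProbabilityMeasure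
  have hcard : (0 : ℝ) < Fintype.card ι := by exact_mod_cast Fintype.card_pos
  obtain ⟨s, hs_card, hs_ball, hs⟩ := exists_isCover_closedBall_card_le (E := E)
  have hs_norm : ∀ x ∈ s, ‖x‖ ≤ 1 := fun x hx => mem_closedBall_zero_iff.1 (hs_ball hx)
  set d := finrank ℝ E
  have hr1 : √((d : ℝ) / Fintype.card ι) ≤ 1 :=
    Real.sqrt_le_one.2 ((div_le_one hcard).2 (by exact_mod_cast hd))
  have hnet := measureReal_exists_mem_le (s := s ×ˢ s) (μ := μ) fun p hp =>
    h.measureReal_abs_covDeviation_gt_le (hs_norm _ (Finset.mem_product.1 hp).1)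
      (hs_norm _ (Finset.mem_product.1 hp).2) (Real.sqrt_nonneg _) hr1
  rw [Real.sq_sqrt (by positivity), mul_assoc, div_mul_cancel₀ _ hcard.ne'] at hnet
  refine (measureReal_mono fun ω hω => ?_).trans (hnet.trans ?_)
  · by_contra hle
    simp only [Set.mem_ofPred_eq, not_exists, not_and, not_lt, Finset.mem_product, and_imp,
      Prod.forall] at hle hω
    have hnorm := opNorm_bilin_le_four_mul_of_isCover hs (covDeviation fun i => ζ i ω)
      fun x hx y hy => hle x y hx hy
    linarith
  · calc ((s ×ˢ s).card : ℝ) * (4 * Real.exp (-(5 * d)))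
        ≤ (5 ^ d * 5 ^ d) * (4 * Real.exp (-(5 * d))) := by
          rw [Finset.card_product]
          push_cast
          gcongr <;> exact_mod_cast hs_card
      _ ≤ (Real.exp (2 * d) * Real.exp (2 * d)) * (4 * Real.exp (-(5 * d))) := by
          gcongr <;> exact five_pow_le_exp d
      _ = 4 * Real.exp (-d) := by
          rw [← Real.exp_add, mul_left_comm, ← Real.exp_add]
          ring_nf

lemma measureReal_norm_sum_smul_gt_le (h : IsIndepSubGaussian μ ζ) {a : ι → ℝ}
    (ha : ∀ i, |a i| ≤ 1) :
    μ.real {ω | 6 * √(finrank ℝ E * Fintype.card ι) < ‖∑ i, a i • ζ i ω‖}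
      ≤ 2 * Real.exp (-finrank ℝ E) := by
  have := h.indep.isProbabilityMeasure
  have hcard : (0 : ℝ) < Fintype.card ι := by exact_mod_cast Fintype.card_pos
  obtain ⟨s, hs_card, hs_ball, hs⟩ := exists_isCover_closedBall_card_le (E := E)
  set d := finrank ℝ E
  have hnet := measureReal_exists_mem_le (s := s) (μ := μ) fun x hx =>
    measureReal_abs_gt_le_of_hasSubgaussianMGF (ε := 3 * √(d * Fintype.card ι))
      (h.hasSubgaussianMGF_inner_sum_smul ha (mem_closedBall_zero_iff.1 (hs_ball hx)))
      (by positivity)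
  refine (measureReal_mono fun ω hω => ?_).trans (hnet.trans ?_)
  · by_contra hle
    simp only [Set.mem_ofPred_eq, not_exists, not_and, not_lt] at hle hω
    have hnorm := opNorm_le_two_mul_of_isCover hs (innerSL ℝ (∑ i, a i • ζ i ω)) fun x hx => by
      rw [innerSL_apply_apply, real_inner_comm]
      exact hle x hx
    rw [innerSL_apply_norm] at hnorm
    linarith
  · have hexponent : -(3 * √(d * Fintype.card ι)) ^ 2 / (2 * Fintype.card ι) ≤ -(3 * d : ℝ) := by
      rw [mul_pow, Real.sq_sqrt (by positivity), div_le_iff₀ (by positivity)]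
      nlinarith [mul_nonneg (Nat.cast_nonneg (α := ℝ) d) hcard.le]
    calc (s.card : ℝ) * (2 * Real.exp (-(3 * √(d * Fintype.card ι)) ^ 2 / (2 * Fintype.card ι)))
        ≤ Real.exp (2 * d) * (2 * Real.exp (-(3 * d))) := by
          gcongr
          exact (by exact_mod_cast hs_card : (s.card : ℝ) ≤ 5 ^ d).trans (five_pow_le_exp d)
      _ = 2 * Real.exp (-d) := by
          rw [mul_left_comm, ← Real.exp_add]
          ring_nf

lemma measureReal_norm_sum_smul_gt_le_of_indepFun (h : IsIndepSubGaussian μ ζ) {a : ι → Ω → ℝ}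
    (hmeas : ∀ i, Measurable (a i)) (ha : ∀ᵐ ω ∂μ, ∀ i, |a i ω| ≤ 1)
    (hind : IndepFun (fun ω i => a i ω) (fun ω i => ζ i ω) μ) :
    μ.real {ω | 6 * √(finrank ℝ E * Fintype.card ι) < ‖∑ i, a i ω • ζ i ω‖}
      ≤ 2 * Real.exp (-finrank ℝ E) := by
  have := h.indep.isProbabilityMeasure
  have hS : MeasurableSet {p : (ι → ℝ) × (ι → E) |
      6 * √(finrank ℝ E * Fintype.card ι) < ‖∑ i, p.1 i • p.2 i‖} :=
    measurableSet_lt measurable_const (by fun_prop)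
  have hfubini := measure_prodMk_mem_le_of_indepFun (measurable_pi_lambda _ hmeas)
    (measurable_pi_lambda _ h.measurable) hind hS
    (b := ENNReal.ofReal (2 * Real.exp (-finrank ℝ E))) (ha.mono fun ω hω => by
      rw [← ofReal_measureReal]
      exact ENNReal.ofReal_le_ofReal (h.measureReal_norm_sum_smul_gt_le hω))
  rw [measure_univ, mul_one] at hfubini
  exact ENNReal.toReal_le_of_le_ofReal (by positivity) hfubini

end IsIndepSubGaussian

end NoiseConcentration

section Bucket

lemma bucketLength_pos {n l : ℕ} (hl : 0 < l) (hln : l ≤ n) : 0 < bucketLength n l :=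
  Nat.div_pos hln hl

lemma mem_bucket {n l : ℕ} {i : Fin l} {j : Fin n} :
    j ∈ bucket n l i ↔
      (i : ℕ) * bucketLength n l ≤ j ∧ (j : ℕ) < ((i : ℕ) + 1) * bucketLength n l := by
  simp only [bucket, Finset.mem_filter, Finset.mem_univ, true_and]

lemma card_bucket {n l : ℕ} (i : Fin l) : (bucket n l i).card = bucketLength n l := by
  have hle : ((i : ℕ) + 1) * bucketLength n l ≤ n :=
    (Nat.mul_le_mul_right _ i.2).trans (Nat.mul_div_le n l)
  have hmap : (bucket n l i).map Fin.valEmbedding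
      = Finset.Ico ((i : ℕ) * bucketLength n l) (((i : ℕ) + 1) * bucketLength n l) := by
    ext a
    simp only [Finset.mem_map, mem_bucket, Fin.valEmbedding_apply, Finset.mem_Ico]
    exact ⟨fun ⟨_, hj, hja⟩ => hja ▸ hj, fun ha => ⟨⟨a, ha.2.trans_le hle⟩, ha, rfl⟩⟩
  rw [← Finset.card_map Fin.valEmbedding, hmap, Nat.card_Ico, add_mul, one_mul,
    Nat.add_sub_cancel_left]

lemma bucket_nonempty {n l : ℕ} (hk : 0 < bucketLength n l) (i : Fin l) :
    (bucket n l i).Nonempty := by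
  rwa [← Finset.card_pos, card_bucket]

lemma pairwise_disjoint_bucket {n l : ℕ} : Pairwise (Function.onFun Disjoint (bucket n l)) := by
  refine fun i j hij => Finset.disjoint_left.2 fun a hai haj => hij (Fin.ext ?_)
  rw [mem_bucket] at hai haj
  have hij' : (i : ℕ) < j + 1 := Nat.lt_of_mul_lt_mul_right (hai.1.trans_lt haj.2)
  have hji' : (j : ℕ) < i + 1 := Nat.lt_of_mul_lt_mul_right (haj.1.trans_lt hai.2)
  lia

lemma abs_bucketMean_le {n l : ℕ} {h : Fin n → ℝ} (hh : ∀ j, |h j| ≤ 1) (i : Fin l) :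
    |bucketMean l h i| ≤ 1 := by
  rw [bucketMean, smul_eq_mul, abs_mul, abs_inv, Nat.abs_cast]
  refine inv_mul_le_one_of_le₀ ?_ (by positivity)
  calc |∑ j ∈ bucket n l i, h j| ≤ ∑ j ∈ bucket n l i, |h j| := Finset.abs_sum_le_sum_abs _ _
    _ ≤ (bucket n l i).card • 1 := Finset.sum_le_card_nsmul _ _ 1 fun j _ => hh j
    _ = bucketLength n l := by rw [card_bucket, nsmul_one]

lemma bucketMean_eq_of_forall_eq {n l : ℕ} (hk : 0 < bucketLength n l) {i : Fin l} {h : Fin n → ℝ}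
    {c : ℝ} (hc : ∀ j ∈ bucket n l i, h j = c) : bucketMean l h i = c := by
  rw [bucketMean, Finset.sum_congr rfl hc, Finset.sum_const, card_bucket, nsmul_eq_mul, smul_eq_mul,
    inv_mul_cancel_left₀ (by positivity)]

end Bucket

section Increments

variable {n : ℕ}

/-- The sign `±1` encoded by a Boolean. -/
def boolSign (b : Bool) : ℝ := if b then 1 else -1

/-- The path of labels `±1` that changes sign exactly at the times `m` with `s m = false`, starting
from a fictitious label `1` at time `-1`. -/
def signPath (s : Fin n → Bool) (j : Fin n) : ℝ := ∏ m ∈ Finset.Iic j, boolSign (s m)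

/-- The label preceding `x j`; the label preceding the first one is taken to be `1`. -/
def prevLabel (x : Fin n → ℝ) (j : Fin n) : ℝ := if (j : ℕ) = 0 then 1 else x ⟨j - 1, by lia⟩

open Classical in
/-- The increments of a path of labels, the inverse of `signPath` on paths with values `±1`:
`true` if the label is the same as the preceding one. -/
def increment (x : Fin n → ℝ) (j : Fin n) : Bool := decide (x j = prevLabel x j)

lemma boolSign_sq (b : Bool) : boolSign b ^ 2 = 1 := by cases b <;> simp [boolSign]

lemma signPath_sq (s : Fin n → Bool) (j : Fin n) : signPath s j ^ 2 = 1 := by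
  rw [signPath, ← Finset.prod_pow]
  exact Finset.prod_eq_one fun m _ => boolSign_sq _

lemma Iic_eq_insert {i j : Fin n} (hij : (j : ℕ) = i + 1) :
    Finset.Iic j = insert j (Finset.Iic i) := by
  ext m
  simp only [Finset.mem_Iic, Finset.mem_insert, Fin.le_def, Fin.ext_iff]
  lia

lemma Iic_eq_singleton {j : Fin n} (hj : (j : ℕ) = 0) : Finset.Iic j = {j} := by
  ext m
  simp only [Finset.mem_Iic, Finset.mem_singleton, Fin.le_def, Fin.ext_iff]
  lia

lemma signPath_succ (s : Fin n → Bool) {i j : Fin n} (hij : (j : ℕ) = i + 1) :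
    signPath s j = boolSign (s j) * signPath s i := by
  rw [signPath, Iic_eq_insert hij, Finset.prod_insert (by simp [Fin.le_def, hij]), signPath]

lemma signPath_eq_boolSign_mul_prevLabel (s : Fin n → Bool) (j : Fin n) :
    signPath s j = boolSign (s j) * prevLabel (signPath s) j := by
  by_cases hj : (j : ℕ) = 0
  · rw [prevLabel, if_pos hj, signPath, Iic_eq_singleton hj, Finset.prod_singleton, mul_one]
  · rw [prevLabel, if_neg hj]
    exact signPath_succ s (Nat.succ_pred_eq_of_ne_zero hj).symm

lemma prevLabel_eq_one_or {x : Fin n → ℝ} (hx : ∀ j, x j = 1 ∨ x j = -1) (j : Fin n) :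
    prevLabel x j = 1 ∨ prevLabel x j = -1 := by
  rw [prevLabel]
  split_ifs
  exacts [Or.inl rfl, hx _]

lemma increment_signPath (s : Fin n → Bool) : increment (signPath s) = s := by
  funext j
  have hprev := prevLabel_eq_one_or (fun m => sq_eq_one_iff.1 (signPath_sq s m)) j
  rw [increment, signPath_eq_boolSign_mul_prevLabel]
  cases s j <;> rcases hprev with h | h <;> norm_num [h, boolSign]

lemma signPath_increment {x : Fin n → ℝ} (hx : ∀ j, x j = 1 ∨ x j = -1) :
    signPath (increment x) = x := by
  have hstep : ∀ j, boolSign (increment x j) * prevLabel x j = x j := fun j => by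
    rcases hx j with h | h <;> rcases prevLabel_eq_one_or hx j with h' | h' <;>
      norm_num [increment, boolSign, h, h']
  funext ⟨i, hi⟩
  induction i with
  | zero => simpa [signPath_eq_boolSign_mul_prevLabel, prevLabel] using hstep ⟨0, hi⟩
  | succ i ih =>
    rw [signPath_succ _ (i := ⟨i, by lia⟩) rfl, ih]
    simpa [prevLabel] using hstep ⟨i + 1, hi⟩

lemma measurable_increment (j : Fin n) : Measurable fun x : Fin n → ℝ => increment x j := by
  have hset : (fun x : Fin n → ℝ => increment x j) ⁻¹' {true} = {x | x j = prevLabel x j} := by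
    ext x
    simp [increment]
  refine measurable_to_bool ?_
  rw [hset]
  refine measurableSet_eq_fun (measurable_pi_apply j) ?_
  unfold prevLabel
  split_ifs
  exacts [measurable_const, measurable_pi_apply _]

-- Flipping a label before the bucket only changes the global sign of the path on the bucket.
lemma sq_bucketMean_signPath_congr {l : ℕ} {i : Fin l} {s t : Fin n → Bool}
    (hst : ∀ j ∈ bucket n l i, s j = t j) :
    bucketMean l (signPath s) i ^ 2 = bucketMean l (signPath t) i ^ 2 := by
  set past := Finset.univ.filter fun m : Fin n => (m : ℕ) < i * bucketLength n l
  set c := ∏ m ∈ past, boolSign (s m) * boolSign (t m)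
  have hc : c ^ 2 = 1 := by
    rw [← Finset.prod_pow]
    exact Finset.prod_eq_one fun m _ => by rw [mul_pow, boolSign_sq, boolSign_sq, one_mul]
  have hprod : ∀ j ∈ bucket n l i, signPath s j = c * signPath t j := fun j hj => by
    have hj' := mem_bucket.1 hj
    have hc_eq : c = signPath s j * signPath t j := by
      rw [signPath, signPath, ← Finset.prod_mul_distrib]
      refine Finset.prod_subset (fun m hm => ?_) fun m hm hm' => ?_
      · simp only [past, Finset.mem_filter, Finset.mem_univ, true_and, Finset.mem_Iic,
          Fin.le_def] at hm ⊢
        lia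
      · simp only [past, Finset.mem_filter, Finset.mem_univ, true_and, Finset.mem_Iic,
          Fin.le_def] at hm hm'
        rw [hst m (mem_bucket.2 (by lia)), ← sq, boolSign_sq]
    rw [hc_eq, mul_assoc, ← sq, signPath_sq, mul_one]
  rw [bucketMean, Finset.sum_congr rfl hprod, ← Finset.mul_sum, bucketMean, smul_eq_mul,
    mul_left_comm, mul_pow, hc, one_mul, smul_eq_mul]

lemma sq_bucketMean_signPath_eq_one {l : ℕ} (hk : 0 < bucketLength n l) {i : Fin l}
    {s : Fin n → Bool} {a : Fin n} (ha : ∀ j ∈ bucket n l i, a ≤ j)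
    (hs : ∀ j ∈ bucket n l i, j ≠ a → s j = true) : bucketMean l (signPath s) i ^ 2 = 1 := by
  have hconst : ∀ j ∈ bucket n l i,
      signPath (Function.update (fun _ => true) a (s a)) j = boolSign (s a) := fun j hj => by
    rw [signPath, Finset.prod_eq_single_of_mem a (Finset.mem_Iic.2 (ha j hj)) fun m _ hm => by
      simp [hm, boolSign], Function.update_self]
  rw [sq_bucketMean_signPath_congr (t := Function.update (fun _ => true) a (s a)) fun j hj => ?_,
    bucketMean_eq_of_forall_eq hk hconst, boolSign_sq]
  by_cases hja : j = a
  · rw [hja, Function.update_self]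
  · rw [Function.update_of_ne hja, hs j hj hja]

end Increments

section Hoeffding

variable {Ω ι : Type*} [MeasurableSpace Ω] {μ : Measure Ω} [Fintype ι] {X : ι → Ω → ℝ} {a b : ℝ}

lemma hasSubgaussianMGF_sum_sub_integral_of_mem_Icc (hind : iIndepFun X μ)
    (hm : ∀ i, AEMeasurable (X i) μ) (hX : ∀ i, ∀ᵐ ω ∂μ, X i ω ∈ Set.Icc a b) :
    HasSubgaussianMGF (fun ω => ∑ i, (X i ω - ∫ ω', X i ω' ∂μ))
      (Fintype.card ι * (‖b - a‖₊ / 2) ^ 2) μ := by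
  have := hind.isProbabilityMeasure
  have hcomp : iIndepFun (fun i ω => X i ω - ∫ ω', X i ω' ∂μ) μ :=
    hind.comp (fun i y => y - ∫ ω', X i ω' ∂μ) fun i => by fun_prop
  simpa using HasSubgaussianMGF.sum_of_iIndepFun hcomp (s := Finset.univ)
    fun i _ => hasSubgaussianMGF_of_mem_Icc (hm i) (hX i)

lemma measureReal_abs_sum_sub_integral_gt_le_of_mem_Icc (hind : iIndepFun X μ)
    (hm : ∀ i, AEMeasurable (X i) μ) (hX : ∀ i, ∀ᵐ ω ∂μ, X i ω ∈ Set.Icc a b) {ε : ℝ}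
    (hε : 0 ≤ ε) :
    μ.real {ω | ε < |∑ i, X i ω - ∑ i, ∫ ω', X i ω' ∂μ|}
      ≤ 2 * Real.exp (-(2 * ε ^ 2) / (Fintype.card ι * (b - a) ^ 2)) := by
  have := hind.isProbabilityMeasure
  have h := measureReal_abs_gt_le_of_hasSubgaussianMGF
    (hasSubgaussianMGF_sum_sub_integral_of_mem_Icc hind hm hX) hε
  simp only [Finset.sum_sub_distrib] at h
  refine h.trans_eq ?_
  rw [← mul_div_mul_left (-ε ^ 2) _ (two_ne_zero (α := ℝ))]
  congr 3
  · ring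
  · push_cast
    rw [Real.norm_eq_abs, div_pow, sq_abs]
    ring

end Hoeffding

section Chain

variable {Ω : Type*} [MeasurableSpace Ω] {μ : Measure Ω} {n : ℕ} {η : Fin n → Ω → ℝ} {δ : ℝ}

/-- The law of the `j`-th increment of a symmetric chain with flip probability `δ`. -/
def incrementLaw (δ : ℝ) (j : Fin n) : Measure Bool :=
  ENNReal.ofReal (if (j : ℕ) = 0 then 1 / 2 else 1 - δ) • Measure.dirac true +
    ENNReal.ofReal (if (j : ℕ) = 0 then 1 / 2 else δ) • Measure.dirac false

lemma isProbabilityMeasure_incrementLaw (h0 : 0 ≤ δ) (h1 : δ ≤ 1) (j : Fin n) :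
    IsProbabilityMeasure (incrementLaw δ j) where
  measure_univ := by
    simp only [incrementLaw, Measure.add_apply, Measure.smul_apply, measure_univ, smul_eq_mul,
      mul_one]
    rw [← ENNReal.ofReal_add (by split_ifs <;> linarith) (by split_ifs <;> linarith)]
    split_ifs <;> norm_num

lemma measureReal_incrementLaw_singleton (h0 : 0 ≤ δ) (h1 : δ ≤ 1) (j : Fin n) (b : Bool) :
    (incrementLaw δ j).real {b} = if (j : ℕ) = 0 then 1 / 2 else if b then 1 - δ else δ := by
  have hnonneg : 0 ≤ if (j : ℕ) = 0 then 1 / 2 else if b then 1 - δ else δ := by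
    split_ifs <;> linarith
  rw [← ENNReal.toReal_ofReal hnonneg]
  cases b <;> simp [Measure.real, incrementLaw]

lemma exp_neg_one_le_one_sub_pow {m : ℕ} (hm : (m + 1) * δ ≤ 1) :
    Real.exp (-1) ≤ (1 - δ) ^ m := by
  rcases m.eq_zero_or_pos with rfl | hpos
  · simp
  have hm' : (0 : ℝ) < m := by positivity
  have hbase : Real.exp (-(m : ℝ)⁻¹) ≤ 1 - δ := by
    calc Real.exp (-(m : ℝ)⁻¹) = (Real.exp (m : ℝ)⁻¹)⁻¹ := Real.exp_neg _
      _ ≤ ((m : ℝ)⁻¹ + 1)⁻¹ := by gcongr; exact Real.add_one_le_exp _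
      _ = 1 - (m + 1 : ℝ)⁻¹ := by field_simp; ring
      _ ≤ 1 - δ := by
        gcongr
        rwa [← one_div, le_div_iff₀' (by positivity)]
  calc Real.exp (-1) = Real.exp (-(m : ℝ)⁻¹) ^ m := by
        rw [← Real.exp_nat_mul, mul_neg, mul_inv_cancel₀ hm'.ne']
    _ ≤ (1 - δ) ^ m := by gcongr

namespace IsSymmetricChain

lemma measureReal_prefix_zero (h : IsSymmetricChain μ δ η) (h0 : 0 ≤ δ) (h1 : δ ≤ 1)
    (s : Fin n → Bool) {i : Fin n} (hi : (i : ℕ) = 0) :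
    μ.real {ω | η i ω = signPath s i} = (incrementLaw δ i).real {s i} := by
  rw [measureReal_incrementLaw_singleton h0 h1, if_pos hi, signPath, Iic_eq_singleton hi,
    Finset.prod_singleton]
  cases s i
  exacts [(h.init i hi).2, (h.init i hi).1]

lemma measureReal_prefix_succ (h : IsSymmetricChain μ δ η) (h0 : 0 ≤ δ) (h1 : δ ≤ 1)
    (s : Fin n → Bool) {i j : Fin n} (hij : (j : ℕ) = i + 1) :
    μ.real {ω | ∀ m ≤ j, η m ω = signPath s m}
      = (incrementLaw δ j).real {s j} * μ.real {ω | ∀ m ≤ i, η m ω = signPath s m} := by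
  have hset : {ω | ∀ m ≤ j, η m ω = signPath s m}
      = {ω | (∀ m ≤ i, η m ω = signPath s m) ∧ η j ω = boolSign (s j) * η i ω} := by
    ext ω
    have hle : ∀ m, m ≤ j ↔ m ≤ i ∨ m = j := fun m => by
      rw [Fin.le_def, Fin.le_def, Fin.ext_iff]
      lia
    simp only [Set.mem_ofPred_eq, hle, or_imp, forall_and, forall_eq, signPath_succ s hij]
    exact and_congr_right fun hpre => by rw [hpre i le_rfl]
  rw [hset, measureReal_incrementLaw_singleton h0 h1, if_neg (by lia)]
  cases s j
  · simpa [boolSign] using h.flip i j hij (signPath s)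
  · simpa [boolSign] using h.stay i j hij (signPath s)

lemma measureReal_prefix (h : IsSymmetricChain μ δ η) (h0 : 0 ≤ δ) (h1 : δ ≤ 1)
    (s : Fin n → Bool) (i : Fin n) :
    μ.real {ω | ∀ m ≤ i, η m ω = signPath s m}
      = ∏ m ∈ Finset.Iic i, (incrementLaw δ m).real {s m} := by
  obtain ⟨i, hi⟩ := i
  induction i with
  | zero =>
    have hle : ∀ m : Fin n, m ≤ ⟨0, hi⟩ ↔ m = ⟨0, hi⟩ := fun m => by
      simp only [Fin.le_def, Fin.ext_iff, Nat.le_zero]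
    simp only [hle, forall_eq]
    rw [h.measureReal_prefix_zero h0 h1 s rfl, Iic_eq_singleton rfl, Finset.prod_singleton]
  | succ i ih =>
    have hij : ((⟨i + 1, hi⟩ : Fin n) : ℕ) = (⟨i, by lia⟩ : Fin n) + 1 := rfl
    rw [h.measureReal_prefix_succ h0 h1 s hij, ih, Iic_eq_insert hij,
      Finset.prod_insert (by simp [Fin.le_def])]

lemma measurable_increment (h : IsSymmetricChain μ δ η) (j : Fin n) :
    Measurable fun ω => increment (fun m => η m ω) j :=
  (MarkovMixture.measurable_increment j).comp (measurable_pi_lambda _ h.measurable)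

lemma ae_abs_le_one (h : IsSymmetricChain μ δ η) : ∀ᵐ ω ∂μ, ∀ j, |η j ω| ≤ 1 := by
  filter_upwards [ae_all_iff.2 h.label] with ω hω j
  rcases hω j with h | h <;> simp [h]

lemma ae_sq_bucketMean_mem_Icc (h : IsSymmetricChain μ δ η) (l : ℕ) (i : Fin l) :
    ∀ᵐ ω ∂μ, bucketMean l (fun j => η j ω) i ^ 2 ∈ Set.Icc (0 : ℝ) 1 := by
  filter_upwards [h.ae_abs_le_one] with ω hω
  exact ⟨sq_nonneg _, (sq_le_one_iff_abs_le_one _).2 (abs_bucketMean_le hω i)⟩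

lemma measurable_bucketMean (h : IsSymmetricChain μ δ η) (l : ℕ) (i : Fin l) :
    Measurable fun ω => bucketMean l (fun j => η j ω) i := by
  have := h.measurable
  unfold bucketMean
  fun_prop

variable [IsProbabilityMeasure μ]

lemma map_increment (h : IsSymmetricChain μ δ η) (h0 : 0 ≤ δ) (h1 : δ ≤ 1) :
    μ.map (fun ω => increment fun j => η j ω) = Measure.pi (incrementLaw δ) := by
  have := fun j : Fin n => isProbabilityMeasure_incrementLaw h0 h1 j
  have hm : Measurable fun ω => increment fun j => η j ω :=
    measurable_pi_lambda _ h.measurable_increment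
  refine Measure.ext_of_singleton fun s => (measureReal_eq_measureReal_iff).1 ?_
  rw [map_measureReal_apply hm (measurableSet_singleton s), Measure.real_def (.pi _),
    Measure.pi_singleton, ENNReal.toReal_prod]
  rcases n with _ | n
  · have huniv : (fun ω => increment fun j => η j ω) ⁻¹' {s} = Set.univ := by
      ext ω
      simp [eq_iff_true_of_subsingleton]
    simp [huniv]
  · have hpre := h.measureReal_prefix h0 h1 s (Fin.last n)
    simp only [Fin.le_last, true_imp_iff] at hpre
    rw [← Fin.top_eq_last, Finset.Iic_top] at hpre
    refine Eq.trans (measureReal_congr ?_) hpre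
    filter_upwards [ae_all_iff.2 h.label] with ω hω
    refine propext (show increment (fun j => η j ω) = s ↔ ∀ m, η m ω = signPath s m from ⟨?_, ?_⟩)
    · rintro rfl m
      rw [signPath_increment hω]
    · intro hs
      rw [funext hs, increment_signPath]

lemma map_increment_apply (h : IsSymmetricChain μ δ η) (h0 : 0 ≤ δ) (h1 : δ ≤ 1) (j : Fin n) :
    μ.map (fun ω => increment (fun m => η m ω) j) = incrementLaw δ j := by
  have := fun j : Fin n => isProbabilityMeasure_incrementLaw h0 h1 j
  rw [← (measurePreserving_eval (incrementLaw δ) j).map_eq, ← h.map_increment h0 h1,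
    Measure.map_map (measurable_pi_apply j) (measurable_pi_lambda _ h.measurable_increment)]
  rfl

lemma iIndepFun_increment (h : IsSymmetricChain μ δ η) (h0 : 0 ≤ δ) (h1 : δ ≤ 1) :
    iIndepFun (fun j ω => increment (fun m => η m ω) j) μ := by
  rw [iIndepFun_iff_map_fun_eq_pi_map fun j => (h.measurable_increment j).aemeasurable]
  simp only [h.map_increment_apply h0 h1]
  exact h.map_increment h0 h1

lemma iIndepFun_sq_bucketMean (h : IsSymmetricChain μ δ η) (h0 : 0 ≤ δ) (h1 : δ ≤ 1) (l : ℕ) :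
    iIndepFun (fun (i : Fin l) ω => bucketMean l (fun j => η j ω) i ^ 2) μ := by
  set extend : ∀ i, (bucket n l i → Bool) → Fin n → Bool :=
    fun i c j => if hj : j ∈ bucket n l i then c ⟨j, hj⟩ else true
  refine (iIndepFun_congr fun i => ?_).1 <|
    iIndepFun_comp_of_pairwise_disjoint (h.iIndepFun_increment h0 h1) h.measurable_increment
      pairwise_disjoint_bucket (g := fun i c => bucketMean l (signPath (extend i c)) i ^ 2)
      fun _ => .of_discrete
  filter_upwards [ae_all_iff.2 h.label] with ω hω
  conv_rhs => rw [← signPath_increment hω]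
  exact sq_bucketMean_signPath_congr fun j hj => by simp only [extend, hj, dif_pos]

lemma integrable_sq_bucketMean (h : IsSymmetricChain μ δ η) (l : ℕ) (i : Fin l) :
    Integrable (fun ω => bucketMean l (fun j => η j ω) i ^ 2) μ :=
  Integrable.of_mem_Icc 0 1 ((h.measurable_bucketMean l i).pow_const 2).aemeasurable
    (h.ae_sq_bucketMean_mem_Icc l i)

lemma expSqNorm_eq_sum_integral (h : IsSymmetricChain μ δ η) (l : ℕ) :
    expSqNorm μ l η = ∑ i : Fin l, ∫ ω, bucketMean l (fun j => η j ω) i ^ 2 ∂μ := by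
  rw [expSqNorm, integral_finsetSum _ fun i _ => h.integrable_sq_bucketMean l i]

lemma measureReal_energy_deviation_gt_le (h : IsSymmetricChain μ δ η) (h0 : 0 ≤ δ) (h1 : δ ≤ 1)
    {l : ℕ} (hl : 0 < l) {t : ℝ} (ht : 0 ≤ t) :
    μ.real {ω | √(t / l) < |(l : ℝ)⁻¹ * ∑ i : Fin l, bucketMean l (fun j => η j ω) i ^ 2
      - expSqNorm μ l η / l|} ≤ 2 * Real.exp (-t) := by
  have hl' : (0 : ℝ) < l := by positivity
  have hscale : √(t * l) = l * √(t / l) := by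
    rw [← Real.sqrt_sq hl'.le, ← Real.sqrt_mul (by positivity), Real.sqrt_sq hl'.le]
    congr 1
    field_simp
  calc _ ≤ μ.real {ω | √(t * l) < |∑ i : Fin l, bucketMean l (fun j => η j ω) i ^ 2
        - ∑ i : Fin l, ∫ ω', bucketMean l (fun j => η j ω') i ^ 2 ∂μ|} := by
        refine measureReal_mono (μ := μ) fun ω hω => ?_
        rw [Set.mem_ofPred_eq] at hω ⊢
        rw [← h.expSqNorm_eq_sum_integral, hscale]
        refine (mul_lt_mul_of_pos_left hω hl').trans_eq ?_
        rw [← abs_of_pos hl', ← abs_mul, abs_of_pos hl']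
        congr 1
        field_simp
    _ ≤ 2 * Real.exp (-(2 * √(t * l) ^ 2) / (Fintype.card (Fin l) * (1 - 0) ^ 2)) :=
        measureReal_abs_sum_sub_integral_gt_le_of_mem_Icc (h.iIndepFun_sq_bucketMean h0 h1 l)
          (fun i => ((h.measurable_bucketMean l i).pow_const 2).aemeasurable)
          (h.ae_sq_bucketMean_mem_Icc l)
          (by positivity)
    _ ≤ 2 * Real.exp (-t) := by
        gcongr
        rw [Real.sq_sqrt (by positivity), Fintype.card_fin, div_le_iff₀ (by positivity)]
        nlinarith

lemma measureReal_forall_increment_eq_true (h : IsSymmetricChain μ δ η) (h0 : 0 ≤ δ) (h1 : δ ≤ 1)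
    {S : Finset (Fin n)} (hS : ∀ j ∈ S, (j : ℕ) ≠ 0) :
    μ.real {ω | ∀ j ∈ S, increment (fun m => η m ω) j = true} = (1 - δ) ^ S.card := by
  have hset : {ω | ∀ j ∈ S, increment (fun m => η m ω) j = true}
      = ⋂ j ∈ S, (fun ω => increment (fun m => η m ω) j) ⁻¹' {true} := by
    ext ω
    simp
  rw [hset, Measure.real, (h.iIndepFun_increment h0 h1).measure_inter_preimage_eq_mul S
    fun _ _ => measurableSet_singleton _, ENNReal.toReal_prod, ← Finset.prod_const]
  refine Finset.prod_congr rfl fun j hj => ?_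
  rw [← Measure.map_apply (h.measurable_increment j) (measurableSet_singleton _),
    h.map_increment_apply h0 h1, ← Measure.real, measureReal_incrementLaw_singleton h0 h1,
    if_neg (hS j hj), if_pos rfl]

lemma pow_le_integral_sq_bucketMean (h : IsSymmetricChain μ δ η) (h0 : 0 ≤ δ) (h1 : δ ≤ 1) {l : ℕ}
    (hk : 0 < bucketLength n l) (i : Fin l) :
    (1 - δ) ^ (bucketLength n l - 1) ≤ ∫ ω, bucketMean l (fun j => η j ω) i ^ 2 ∂μ := by
  set a := (bucket n l i).min' (bucket_nonempty hk i)
  have ha : ∀ j ∈ bucket n l i, a ≤ j := fun j hj => Finset.min'_le _ _ hj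
  set S := (bucket n l i).erase a
  have hS : ∀ j ∈ S, (j : ℕ) ≠ 0 := fun j hj => by
    have hlt : a < j :=
      (ha j (Finset.mem_of_mem_erase hj)).lt_of_ne (Finset.ne_of_mem_erase hj).symm
    exact (Nat.zero_le _ |>.trans_lt hlt).ne'
  have hcard : S.card = bucketLength n l - 1 := by
    rw [Finset.card_erase_of_mem (Finset.min'_mem _ _), card_bucket]
  calc (1 - δ) ^ (bucketLength n l - 1)
      = μ.real {ω | ∀ j ∈ S, increment (fun m => η m ω) j = true} := by
        rw [h.measureReal_forall_increment_eq_true h0 h1 hS, hcard]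
    _ ≤ μ.real {ω | 1 ≤ bucketMean l (fun j => η j ω) i ^ 2} := by
        refine ENNReal.toReal_mono (measure_ne_top _ _) (measure_mono_ae ?_)
        filter_upwards [ae_all_iff.2 h.label] with ω hω hinc
        have hsq := sq_bucketMean_signPath_eq_one hk ha fun j hj hja =>
          hinc j (Finset.mem_erase.2 ⟨hja, hj⟩)
        rw [signPath_increment hω] at hsq
        exact hsq.ge
    _ ≤ ∫ ω, bucketMean l (fun j => η j ω) i ^ 2 ∂μ := by
        simpa using mul_meas_ge_le_integral_of_nonneg (.of_forall fun ω => sq_nonneg _)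
          (h.integrable_sq_bucketMean l i) 1

lemma exp_neg_one_mul_le_expSqNorm (h : IsSymmetricChain μ δ η) (h0 : 0 ≤ δ) (h1 : δ ≤ 1) {l : ℕ}
    (hk : 0 < bucketLength n l) (hkδ : bucketLength n l * δ ≤ 1) :
    Real.exp (-1) * l ≤ expSqNorm μ l η := by
  have hmean : ∀ i : Fin l, Real.exp (-1) ≤ ∫ ω, bucketMean l (fun j => η j ω) i ^ 2 ∂μ :=
    fun i => (exp_neg_one_le_one_sub_pow (by rwa [← Nat.cast_add_one,
      Nat.sub_add_cancel hk])).trans (h.pow_le_integral_sq_bucketMean h0 h1 hk i)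
  rw [h.expSqNorm_eq_sum_integral, mul_comm]
  simpa using Finset.card_nsmul_le_sum Finset.univ _ _ fun i _ => hmean i

lemma ae_sum_sq_bucketMean_eq_expSqNorm (h : IsSymmetricChain μ δ η) {l : ℕ}
    (hk : bucketLength n l = 1) :
    ∀ᵐ ω ∂μ, ∑ i : Fin l, bucketMean l (fun j => η j ω) i ^ 2 = expSqNorm μ l η := by
  have hae : ∀ᵐ ω ∂μ, ∑ i : Fin l, bucketMean l (fun j => η j ω) i ^ 2 = l := by
    filter_upwards [ae_all_iff.2 h.label] with ω hω
    have hone : ∀ i : Fin l, bucketMean l (fun j => η j ω) i ^ 2 = 1 := fun i => by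
      obtain ⟨j, hj⟩ := Finset.card_eq_one.1 ((card_bucket (n := n) i).trans hk)
      rw [bucketMean, hk, hj, Finset.sum_singleton, Nat.cast_one, inv_one, one_smul,
        sq_eq_one_iff]
      exact hω j
    simp [hone]
  have hE : expSqNorm μ l η = l := by
    rw [expSqNorm, integral_congr_ae hae, integral_const, probReal_univ, one_smul]
  rwa [hE]

end IsSymmetricChain

end Chain

section SignalPlusNoise

variable {ι E : Type*} [Fintype ι] [NormedAddCommGroup E] [InnerProductSpace ℝ E]

lemma sum_inner_signal_add_noise_mul_inner (a : ι → ℝ) (s : ℝ) (ζ : ι → E) (θ x y : E) :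
    (Fintype.card ι : ℝ)⁻¹ * ∑ i, inner ℝ (a i • θ + s • ζ i) x * inner ℝ (a i • θ + s • ζ i) y
      = (Fintype.card ι : ℝ)⁻¹ * (∑ i, a i ^ 2) * (inner ℝ θ x * inner ℝ θ y)
        + s / Fintype.card ι * (inner ℝ θ x * inner ℝ (∑ i, a i • ζ i) y
          + inner ℝ (∑ i, a i • ζ i) x * inner ℝ θ y)
        + s ^ 2 * (covDeviation ζ x y + inner ℝ x y) := by
  rw [covDeviation_apply, sub_add_cancel, div_eq_mul_inv]
  simp only [inner_add_left, real_inner_smul_left, sum_inner, Finset.mul_sum, Finset.sum_mul,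
    ← Finset.sum_add_distrib]
  exact Finset.sum_congr rfl fun i _ => by ring

lemma abs_sum_inner_signal_add_noise_sub_le (a : ι → ℝ) {s : ℝ} (hs : 0 ≤ s) (ζ : ι → E) (b : ℝ)
    (θ x y : E) :
    |(Fintype.card ι : ℝ)⁻¹ * ∑ i, inner ℝ (a i • θ + s • ζ i) x * inner ℝ (a i • θ + s • ζ i) y
        - s ^ 2 * inner ℝ x y - b * (inner ℝ θ x * inner ℝ θ y)|
      ≤ (|(Fintype.card ι : ℝ)⁻¹ * ∑ i, a i ^ 2 - b| * ‖θ‖ ^ 2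
          + 2 * ‖θ‖ * (s / Fintype.card ι * ‖∑ i, a i • ζ i‖) + s ^ 2 * ‖covDeviation ζ‖)
        * ‖x‖ * ‖y‖ := by
  rw [sum_inner_signal_add_noise_mul_inner]
  set A := (Fintype.card ι : ℝ)⁻¹ * ∑ i, a i ^ 2
  set u := ∑ i, a i • ζ i
  set c := s / Fintype.card ι
  have hc : 0 ≤ c := by positivity
  have hθx := abs_real_inner_le_norm θ x
  have hθy := abs_real_inner_le_norm θ y
  have hsignal : |(A - b) * (inner ℝ θ x * inner ℝ θ y)|
      ≤ |A - b| * (‖θ‖ * ‖x‖ * (‖θ‖ * ‖y‖)) := by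
    rw [abs_mul, abs_mul]
    gcongr
  have hcross : |c * (inner ℝ θ x * inner ℝ u y + inner ℝ u x * inner ℝ θ y)|
      ≤ c * (‖θ‖ * ‖x‖ * (‖u‖ * ‖y‖) + ‖u‖ * ‖x‖ * (‖θ‖ * ‖y‖)) := by
    rw [abs_mul, abs_of_nonneg hc]
    gcongr
    refine (abs_add_le _ _).trans ?_
    rw [abs_mul, abs_mul]
    gcongr <;> exact abs_real_inner_le_norm _ _
  have hnoise : |s ^ 2 * covDeviation ζ x y| ≤ s ^ 2 * (‖covDeviation ζ‖ * ‖x‖ * ‖y‖) := by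
    rw [abs_mul, abs_of_nonneg (sq_nonneg s)]
    gcongr
    exact (covDeviation ζ).le_opNorm₂ x y
  calc _ = |(A - b) * (inner ℝ θ x * inner ℝ θ y)
          + c * (inner ℝ θ x * inner ℝ u y + inner ℝ u x * inner ℝ θ y)
          + s ^ 2 * covDeviation ζ x y| := by
        congr 1
        ring
    _ ≤ _ := abs_add_three _ _ _
    _ ≤ _ := add_le_add_three hsignal hcross hnoise
    _ = _ := by ring

end SignalPlusNoise

section SpectralEstimator

open Matrix

variable {n d : ℕ}

lemma isSymm_sampleCov (l : ℕ) (Y : Fin n → EuclideanSpace ℝ (Fin d)) :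
    (sampleCov l Y).IsSymm := by
  rw [Matrix.IsSymm, sampleCov, transpose_smul, transpose_mul, transpose_transpose]

lemma dotProduct_ofLp (x y : EuclideanSpace ℝ (Fin d)) : x.ofLp ⬝ᵥ y.ofLp = inner ℝ x y := by
  rw [real_inner_comm, EuclideanSpace.inner_eq_star_dotProduct, star_trivial]

lemma dotProduct_mulVec_le_lambdaMax {A : Matrix (Fin d) (Fin d) ℝ} (hA : A.IsSymm)
    (x : EuclideanSpace ℝ (Fin d)) :
    x.ofLp ⬝ᵥ A *ᵥ x.ofLp ≤ lambdaMax A * ‖x‖ ^ 2 := by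
  have hH : A.IsHermitian := by rwa [Matrix.IsHermitian, conjTranspose_eq_transpose_of_trivial]
  have hpsd : (algebraMap ℝ (Matrix (Fin d) (Fin d) ℝ) (lambdaMax A) - A).PosSemidef := by
    rw [posSemidef_iff_isHermitian_and_spectrum_nonneg, ← spectrum.singleton_sub_eq]
    refine ⟨.sub ?_ hH, ?_⟩
    · rw [Matrix.IsHermitian, conjTranspose_eq_transpose_of_trivial, algebraMap_eq_diagonal,
        diagonal_transpose]
    · rintro _ ⟨a, rfl, b, hb, rfl⟩
      exact sub_nonneg.2 (le_csSup A.finite_real_spectrum.bddAbove hb)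
  have hnonneg := hpsd.dotProduct_mulVec_nonneg x.ofLp
  rw [star_trivial, sub_mulVec, dotProduct_sub, Algebra.algebraMap_eq_smul_one, smul_mulVec,
    one_mulVec, dotProduct_smul, smul_eq_mul, dotProduct_ofLp, real_inner_self_eq_norm_sq]
    at hnonneg
  linarith

lemma dotProduct_sampleCov_mulVec (l : ℕ) (Y : Fin n → EuclideanSpace ℝ (Fin d))
    (x y : EuclideanSpace ℝ (Fin d)) :
    x.ofLp ⬝ᵥ sampleCov l Y *ᵥ y.ofLp
      = (l : ℝ)⁻¹ * ∑ i : Fin l, inner ℝ (bucketMean l Y i) x * inner ℝ (bucketMean l Y i) y := by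
  rw [sampleCov, smul_mulVec, dotProduct_smul, smul_eq_mul, ← mulVec_mulVec, dotProduct_mulVec,
    mulVec_transpose]
  simp only [← dotProduct_ofLp]
  refine congrArg _ (Finset.sum_congr rfl fun i _ => ?_)
  rw [dotProduct_comm _ x.ofLp, dotProduct_comm _ y.ofLp]
  rfl

lemma thetaHat_eq {vmax : Matrix (Fin d) (Fin d) ℝ → EuclideanSpace ℝ (Fin d)} {l : ℕ} {E : ℝ}
    (hE : 0 ≤ E) (Y : Fin n → EuclideanSpace ℝ (Fin d)) :
    thetaHat vmax l E Y
      = √(max ((lambdaMax (sampleCov l Y) - (bucketLength n l : ℝ)⁻¹) / (E / l)) 0) •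
        vmax (sampleCov l Y) := by
  rw [thetaHat, mul_max_of_nonneg _ _ (by positivity), mul_zero, one_div, ← inv_div, mul_comm,
    div_eq_mul_inv _ (E / l)]

section

variable {vmax : Matrix (Fin d) (Fin d) ℝ → EuclideanSpace ℝ (Fin d)} {l : ℕ} {E q : ℝ}
  {Y : Fin n → EuclideanSpace ℝ (Fin d)} {θ : EuclideanSpace ℝ (Fin d)}

lemma abs_lambdaMax_mul_inner_sub_le (hv : IsTopEigenvectorMap vmax) (hE : 0 < E / l)
    (h : ∀ x y : EuclideanSpace ℝ (Fin d), |x.ofLp ⬝ᵥ sampleCov l Y *ᵥ y.ofLp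
      - (bucketLength n l : ℝ)⁻¹ * inner ℝ x y - E / l * (inner ℝ θ x * inner ℝ θ y)|
        ≤ q * ‖x‖ * ‖y‖) (x : EuclideanSpace ℝ (Fin d)) :
    |(lambdaMax (sampleCov l Y) - (bucketLength n l : ℝ)⁻¹) / (E / l)
        * inner ℝ x (vmax (sampleCov l Y)) - inner ℝ θ x * inner ℝ θ (vmax (sampleCov l Y))|
      ≤ q / (E / l) * ‖x‖ := by
  obtain ⟨hnorm, heigen⟩ := hv _ (isSymm_sampleCov l Y)
  have hx := h x (vmax (sampleCov l Y))
  rw [heigen, dotProduct_smul, dotProduct_ofLp, smul_eq_mul, hnorm, mul_one] at hx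
  generalize E / l = a at hx hE ⊢
  rw [div_mul_eq_mul_div q, le_div_iff₀ hE]
  nth_rw 2 [← abs_of_pos hE]
  rw [← abs_mul, sub_mul, mul_right_comm, div_mul_cancel₀ _ hE.ne', sub_mul, mul_comm _ a]
  exact hx

lemma norm_sq_sub_le_lambdaMax (hv : IsTopEigenvectorMap vmax) (hE : 0 < E / l)
    (h : ∀ x y : EuclideanSpace ℝ (Fin d), |x.ofLp ⬝ᵥ sampleCov l Y *ᵥ y.ofLp
      - (bucketLength n l : ℝ)⁻¹ * inner ℝ x y - E / l * (inner ℝ θ x * inner ℝ θ y)|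
        ≤ q * ‖x‖ * ‖y‖) :
    ‖θ‖ ^ 2 - q / (E / l)
      ≤ (lambdaMax (sampleCov l Y) - (bucketLength n l : ℝ)⁻¹) / (E / l) := by
  rcases eq_or_ne θ 0 with rfl | hθ
  · have hself := abs_lambdaMax_mul_inner_sub_le hv hE h (vmax (sampleCov l Y))
    rw [real_inner_self_eq_norm_sq, (hv _ (isSymm_sampleCov l Y)).1] at hself
    simpa using neg_le_of_abs_le hself
  · have hθθ := neg_le_of_abs_le (h θ θ)
    have htop := dotProduct_mulVec_le_lambdaMax (isSymm_sampleCov l Y) θ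
    rw [real_inner_self_eq_norm_sq] at hθθ
    rw [le_div_iff₀ hE, sub_mul, div_mul_cancel₀ _ hE.ne']
    refine le_of_mul_le_mul_right ?_ (show 0 < ‖θ‖ ^ 2 by positivity)
    linarith

lemma loss_thetaHat_sq_le_of_abs_sub_le (hv : IsTopEigenvectorMap vmax) (hE : 0 < E / l)
    (h : ∀ x y : EuclideanSpace ℝ (Fin d), |x.ofLp ⬝ᵥ sampleCov l Y *ᵥ y.ofLp
      - (bucketLength n l : ℝ)⁻¹ * inner ℝ x y - E / l * (inner ℝ θ x * inner ℝ θ y)|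
        ≤ q * ‖x‖ * ‖y‖) :
    loss (thetaHat vmax l E Y) θ ^ 2 ≤ 3 * (q / (E / l)) ∧
      loss (thetaHat vmax l E Y) θ ^ 2 * ‖θ‖ ^ 2 ≤ 12 * (q / (E / l)) ^ 2 := by
  have hnorm := (hv _ (isSymm_sampleCov l Y)).1
  have hvec := abs_lambdaMax_mul_inner_sub_le hv hE h
  have hval := norm_sq_sub_le_lambdaMax hv hE h
  have hE0 : 0 ≤ E := le_of_lt <| by
    by_contra! hneg
    exact hE.not_ge (div_nonpos_of_nonpos_of_nonneg hneg l.cast_nonneg)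
  rw [thetaHat_eq hE0]
  exact ⟨loss_sq_le_of_perturbation hnorm hvec hval,
    loss_sq_mul_norm_sq_le_of_perturbation hnorm hvec hval⟩

end

end SpectralEstimator

section GoodSample

variable {n d l : ℕ}

/-- The samples on which the estimator with `l` buckets is accurate: the energy of the bucketed
labels, their correlation with the bucketed noise, and the covariance of the bucketed noise are all
close to their means. Here `E` stands for the mean energy `𝐄 ‖η̄‖²`, while `h` and `z` are the
labels and the noise, whose normalized sums are `√k` times the bucket means. -/
structure IsGoodSample (l : ℕ) (E : ℝ) (h : Fin n → ℝ) (z : Fin n → EuclideanSpace ℝ (Fin d)) :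
    Prop where
  energy : |(l : ℝ)⁻¹ * ∑ i, bucketMean l h i ^ 2 - E / l| ≤ √(d / l)
  energy_eq : bucketLength n l = 1 → ∑ i, bucketMean l h i ^ 2 = E
  cross : ‖∑ i, bucketMean l h i • normalizedSum (bucket n l i) z‖ ≤ 6 * √(d * l)
  noise : ‖covDeviation fun i => normalizedSum (bucket n l i) z‖ ≤ 1664 * √(d / l)

variable {Ω : Type*} [MeasurableSpace Ω] {μ : Measure Ω} {δ : ℝ} {η : Fin n → Ω → ℝ}
  {ξ : Fin n → Ω → EuclideanSpace ℝ (Fin d)}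

lemma measure_not_isGoodSample_le (hη : IsSymmetricChain μ δ η) (hξ : IsIndepSubGaussian μ ξ)
    (hind : IndepFun (fun ω i => η i ω) (fun ω i => ξ i ω) μ) (h0 : 0 ≤ δ) (h1 : δ ≤ 1)
    (hl : 0 < l) (hdl : d ≤ l) (hln : l ≤ n) :
    μ {ω | ¬ IsGoodSample l (expSqNorm μ l η) (fun i => η i ω) fun i => ξ i ω}
      ≤ ENNReal.ofReal (8 * Real.exp (-d)) := by
  have := hξ.indep.isProbabilityMeasure
  have : Nonempty (Fin l) := ⟨⟨0, hl⟩⟩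
  have hζ := hξ.normalizedSum_of_pairwise_disjoint
    (bucket_nonempty (bucketLength_pos hl hln)) pairwise_disjoint_bucket
  have henergy := hη.measureReal_energy_deviation_gt_le h0 h1 hl d.cast_nonneg
  have hcross := hζ.measureReal_norm_sum_smul_gt_le_of_indepFun
    (a := fun i ω => bucketMean l (fun j => η j ω) i) (hη.measurable_bucketMean l)
    (hη.ae_abs_le_one.mono fun ω hω => abs_bucketMean_le hω)
    (hind.comp (φ := fun x i => bucketMean l x i)
      (ψ := fun z i => normalizedSum (bucket n l i) z)
      (by unfold bucketMean; fun_prop) (by unfold normalizedSum; fun_prop))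
  have hnoise := hζ.measureReal_norm_covDeviation_gt_le (by simpa using hdl)
  have henergy_eq : μ.real {ω | ¬ (bucketLength n l = 1 →
      ∑ i : Fin l, bucketMean l (fun j => η j ω) i ^ 2 = expSqNorm μ l η)} = 0 := by
    rw [measureReal_eq_zero_iff, ← ae_iff, ae_all_iff]
    exact fun hk => hη.ae_sum_sq_bucketMean_eq_expSqNorm hk
  simp only [finrank_euclideanSpace, Fintype.card_fin] at hcross hnoise
  rw [← ofReal_measureReal]
  refine ENNReal.ofReal_le_ofReal ?_
  calc _ ≤ μ.real (_ ∪ (_ ∪ (_ ∪ _))) := measureReal_mono (μ := μ) fun ω hω => ?_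
    _ ≤ _ := (measureReal_union_le _ _).trans <| add_le_add henergy <|
      (measureReal_union_le _ _).trans <| add_le_add henergy_eq.le <|
      (measureReal_union_le _ _).trans <| add_le_add hcross hnoise
    _ = _ := by ring
  by_contra hgood
  simp only [Set.mem_union, Set.mem_ofPred_eq, not_or, not_not, not_lt] at hgood
  exact hω ⟨hgood.1, hgood.2.1, hgood.2.2.1, hgood.2.2.2⟩

lemma bucketMean_signal_add_noise (h : Fin n → ℝ)
    (z : Fin n → EuclideanSpace ℝ (Fin d)) (θ : EuclideanSpace ℝ (Fin d)) (i : Fin l) :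
    bucketMean l (fun j => h j • θ + z j) i
      = bucketMean l h i • θ + (√(bucketLength n l))⁻¹ • normalizedSum (bucket n l i) z := by
  have hscale : (√(bucketLength n l : ℝ))⁻¹ * (√(bucketLength n l : ℝ))⁻¹
      = (bucketLength n l : ℝ)⁻¹ := by
    rw [← mul_inv, Real.mul_self_sqrt (Nat.cast_nonneg _)]
  rw [normalizedSum, card_bucket, smul_smul, hscale, bucketMean, bucketMean,
    Finset.sum_add_distrib, smul_add, ← Finset.sum_smul, smul_assoc]

lemma le_two_mul_mul_bucketLength (hl : 0 < l) (hln : l ≤ n) :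
    (n : ℝ) ≤ 2 * (l * bucketLength n l) := by
  have hlt : n < l * (bucketLength n l + 1) := Nat.lt_mul_div_succ n hl
  have hle : l * 1 ≤ l * bucketLength n l := Nat.mul_le_mul_left _ (bucketLength_pos hl hln)
  have : n ≤ 2 * (l * bucketLength n l) := by lia
  exact_mod_cast this

lemma cross_term_le (hl : 0 < l) (hln : l ≤ n) {t ρ : ℝ} (hρ : 0 ≤ ρ)
    (hcross : t ^ 2 * (d / n) ≤ ρ ^ 2) :
    t * ((√(bucketLength n l))⁻¹ / l * √(d * l)) ≤ 2 * ρ := by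
  have hn : (0 : ℝ) < n := by exact_mod_cast hl.trans_le hln
  have hk : (0 : ℝ) < bucketLength n l := by exact_mod_cast bucketLength_pos hl hln
  refine le_of_sq_le_sq ?_ (by positivity)
  rw [mul_pow, mul_pow, Real.sq_sqrt (by positivity), div_pow, inv_pow, Real.sq_sqrt hk.le]
  calc t ^ 2 * ((bucketLength n l : ℝ)⁻¹ / (l : ℝ) ^ 2 * (d * l))
      = t ^ 2 * (d / (l * bucketLength n l)) := by field_simp
    _ ≤ t ^ 2 * (d / (n / 2)) := by
        gcongr
        linarith [le_two_mul_mul_bucketLength hl hln]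
    _ = 2 * (t ^ 2 * (d / n)) := by field_simp
    _ ≤ (2 * ρ) ^ 2 := by linarith [sq_nonneg ρ]

lemma noise_term_le (hl : 0 < l) (hln : l ≤ n) {ρ : ℝ} (hρ : 0 ≤ ρ)
    (hnoise : (d : ℝ) / n * (l / n) ≤ 4 * ρ ^ 2) :
    (bucketLength n l : ℝ)⁻¹ * √(d / l) ≤ 4 * ρ := by
  have hn : (0 : ℝ) < n := by exact_mod_cast hl.trans_le hln
  have hk : (0 : ℝ) < bucketLength n l := by exact_mod_cast bucketLength_pos hl hln
  have hk_inv : (bucketLength n l : ℝ)⁻¹ ≤ 2 * l / n := by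
    rw [inv_le_comm₀ hk (by positivity), inv_div, div_le_iff₀ (by positivity)]
    linarith [le_two_mul_mul_bucketLength hl hln]
  refine le_of_sq_le_sq ?_ (by positivity)
  rw [mul_pow, Real.sq_sqrt (by positivity)]
  calc (bucketLength n l : ℝ)⁻¹ ^ 2 * (d / l) ≤ (2 * l / n : ℝ) ^ 2 * (d / l) := by gcongr
    _ = 4 * ((d : ℝ) / n * (l / n)) := by
        field_simp
        ring
    _ ≤ (4 * ρ) ^ 2 := by linarith

namespace IsGoodSample

variable {E ρ : ℝ} {h : Fin n → ℝ} {z : Fin n → EuclideanSpace ℝ (Fin d)}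
  {θ : EuclideanSpace ℝ (Fin d)}

lemma energy_term_le (hs : IsGoodSample l E h z) (hρ : 0 ≤ ρ)
    (henergy : bucketLength n l = 1 ∨ √(d / l) * ‖θ‖ ^ 2 ≤ ρ) :
    |(l : ℝ)⁻¹ * ∑ i, bucketMean l h i ^ 2 - E / l| * ‖θ‖ ^ 2 ≤ ρ := by
  rcases henergy with hk | henergy
  · rwa [hs.energy_eq hk, inv_mul_eq_div, sub_self, abs_zero, zero_mul]
  · exact (mul_le_mul_of_nonneg_right hs.energy (sq_nonneg _)).trans henergy

lemma abs_dotProduct_sampleCov_sub_le (hs : IsGoodSample l E h z) (hl : 0 < l) (hln : l ≤ n)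
    (hρ : 0 ≤ ρ) (henergy : bucketLength n l = 1 ∨ √(d / l) * ‖θ‖ ^ 2 ≤ ρ)
    (hcross : ‖θ‖ ^ 2 * (d / n) ≤ ρ ^ 2) (hnoise : (d : ℝ) / n * (l / n) ≤ 4 * ρ ^ 2)
    (x y : EuclideanSpace ℝ (Fin d)) :
    |x.ofLp ⬝ᵥ (sampleCov l fun j => h j • θ + z j).mulVec y.ofLp
        - (bucketLength n l : ℝ)⁻¹ * inner ℝ x y - E / l * (inner ℝ θ x * inner ℝ θ y)|
      ≤ 6681 * ρ * ‖x‖ * ‖y‖ := by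
  have hscale : (√(bucketLength n l : ℝ))⁻¹ ^ 2 = (bucketLength n l : ℝ)⁻¹ := by
    rw [inv_pow, Real.sq_sqrt (Nat.cast_nonneg _)]
  have hdev := abs_sum_inner_signal_add_noise_sub_le (fun i => bucketMean l h i)
    (s := (√(bucketLength n l : ℝ))⁻¹) (by positivity)
    (fun i => normalizedSum (bucket n l i) z) (E / l) θ x y
  rw [Fintype.card_fin, hscale] at hdev
  rw [dotProduct_sampleCov_mulVec]
  simp only [bucketMean_signal_add_noise]
  refine hdev.trans ?_
  gcongr
  have hcross_term := cross_term_le hl hln hρ hcross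
  have hnoise_term := noise_term_le hl hln hρ hnoise
  calc _ ≤ ρ + 2 * ‖θ‖ * ((√(bucketLength n l : ℝ))⁻¹ / l * (6 * √(d * l)))
        + (bucketLength n l : ℝ)⁻¹ * (1664 * √(d / l)) := by
        gcongr
        exacts [hs.energy_term_le hρ henergy, hs.cross, hs.noise]
    _ = ρ + 12 * (‖θ‖ * ((√(bucketLength n l : ℝ))⁻¹ / l * √(d * l)))
        + 1664 * ((bucketLength n l : ℝ)⁻¹ * √(d / l)) := by ring
    _ ≤ 6681 * ρ := by linarith

lemma loss_thetaHat_sq_le (hs : IsGoodSample l E h z)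
    {vmax : Matrix (Fin d) (Fin d) ℝ → EuclideanSpace ℝ (Fin d)} (hv : IsTopEigenvectorMap vmax)
    (hl : 0 < l) (hln : l ≤ n) (hE : Real.exp (-1) * l ≤ E) (hρ : 0 ≤ ρ)
    (henergy : bucketLength n l = 1 ∨ √(d / l) * ‖θ‖ ^ 2 ≤ ρ)
    (hcross : ‖θ‖ ^ 2 * (d / n) ≤ ρ ^ 2) (hnoise : (d : ℝ) / n * (l / n) ≤ 4 * ρ ^ 2) :
    loss (thetaHat vmax l E fun j => h j • θ + z j) θ ^ 2 ≤ 60129 * ρ ∧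
      loss (thetaHat vmax l E fun j => h j • θ + z j) θ ^ 2 * ‖θ‖ ^ 2
        ≤ 12 * (20043 * ρ) ^ 2 := by
  have hEl : (1 : ℝ) / 3 ≤ E / l := by
    refine le_trans ?_ ((le_div_iff₀ (by positivity)).2 hE)
    rw [Real.exp_neg, one_div]
    gcongr
    exact Real.exp_one_lt_three.le
  have hq : 6681 * ρ / (E / l) ≤ 20043 * ρ := by
    rw [div_le_iff₀ (by positivity)]
    nlinarith
  obtain ⟨hloss, hloss_mul⟩ := loss_thetaHat_sq_le_of_abs_sub_le hv (by positivity)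
    (hs.abs_dotProduct_sampleCov_sub_le hl hln hρ henergy hcross hnoise)
  refine ⟨hloss.trans (by linarith), hloss_mul.trans ?_⟩
  gcongr

end IsGoodSample

end GoodSample

section NumberOfBuckets

lemma sqrt_div_mul_le_sqrt_mul_div {x a b c t : ℝ} (hx : 0 ≤ x) (ha : 0 < a) (hb : 0 < b)
    (h : t ^ 2 * b ≤ c * a) : √(x / a) * t ≤ √(c * (x / b)) := by
  refine Real.le_sqrt_of_sq_le ?_
  rw [mul_pow, Real.sq_sqrt (by positivity), div_mul_eq_mul_div, mul_div_assoc',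
    div_le_div_iff₀ ha hb]
  nlinarith [mul_le_mul_of_nonneg_left h hx]

variable {n d : ℕ} {δ : ℝ} {θ : EuclideanSpace ℝ (Fin d)}

lemma le_ellStar : d ≤ ellStar n δ θ := le_max_left _ _

lemma ellStar_le (hdn : d ≤ n) : ellStar n δ θ ≤ n := max_le hdn (min_le_right _ _)

lemma mul_le_ellStar (h1 : δ ≤ 1) : (n : ℝ) * δ ≤ ellStar n δ θ := by
  rw [ellStar, Nat.cast_max, Nat.cast_min]
  refine le_max_of_le_right (le_min (le_trans ?_ (Nat.le_ceil _)) ?_)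
  · gcongr
    exact le_max_left _ _
  · exact mul_le_of_le_one_right n.cast_nonneg h1

lemma mul_norm_sq_le_ellStar_of_lt (h : ellStar n δ θ < n) :
    (n : ℝ) * ‖θ‖ ^ 2 ≤ ellStar n δ θ := by
  have hceil : ⌈(n : ℝ) * max δ (‖θ‖ ^ 2)⌉₊ ≤ ellStar n δ θ := by
    rw [ellStar] at h ⊢
    lia
  calc (n : ℝ) * ‖θ‖ ^ 2 ≤ n * max δ (‖θ‖ ^ 2) := by
        gcongr
        exact le_max_right _ _
    _ ≤ ellStar n δ θ := (Nat.le_ceil _).trans (by exact_mod_cast hceil)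

lemma ellStar_div_le (hd : 1 ≤ d) (hdn : d ≤ n) (h0 : 0 ≤ δ) :
    (ellStar n δ θ : ℝ) / n ≤ 2 * (d / n) + (δ + ‖θ‖ ^ 2) := by
  have hn : (0 : ℝ) < n := by exact_mod_cast hd.trans hdn
  have hd' : (1 : ℝ) ≤ d := by exact_mod_cast hd
  have hmax : max δ (‖θ‖ ^ 2) ≤ δ + ‖θ‖ ^ 2 := max_le_add_of_nonneg h0 (sq_nonneg _)
  have hceil := (Nat.ceil_lt_add_one (a := (n : ℝ) * max δ (‖θ‖ ^ 2)) (by positivity)).le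
  rw [div_le_iff₀ hn, add_mul, mul_assoc, div_mul_cancel₀ _ hn.ne', mul_comm _ (n : ℝ), ellStar,
    Nat.cast_max, Nat.cast_min]
  refine max_le ?_ ((min_le_left _ _).trans ?_)
  · linarith [show 0 ≤ (n : ℝ) * (δ + ‖θ‖ ^ 2) by positivity]
  · linarith [mul_le_mul_of_nonneg_left hmax hn.le]

lemma bucketLength_ellStar_mul_le_one (hd : 1 ≤ d) (h0 : 0 ≤ δ) (h1 : δ ≤ 1) :
    bucketLength n (ellStar n δ θ) * δ ≤ 1 := by
  have hl : (0 : ℝ) < ellStar n δ θ := by exact_mod_cast hd.trans le_ellStar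
  calc (bucketLength n (ellStar n δ θ) : ℝ) * δ ≤ n / ellStar n δ θ * δ := by
        gcongr
        exact Nat.cast_div_le
    _ = n * δ / ellStar n δ θ := by ring
    _ ≤ 1 := (div_le_one hl).2 (mul_le_ellStar h1)

lemma IsSymmetricChain.exp_neg_one_mul_ellStar_le_expSqNorm {Ω : Type*} [MeasurableSpace Ω]
    {μ : Measure Ω} [IsProbabilityMeasure μ] {η : Fin n → Ω → ℝ} (hη : IsSymmetricChain μ δ η)
    (hd : 1 ≤ d) (hdn : d ≤ n) (h0 : 0 ≤ δ) (h1 : δ ≤ 1) :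
    Real.exp (-1) * ellStar n δ θ ≤ expSqNorm μ (ellStar n δ θ) η :=
  hη.exp_neg_one_mul_le_expSqNorm h0 h1 (bucketLength_pos (hd.trans le_ellStar) (ellStar_le hdn))
    (bucketLength_ellStar_mul_le_one hd h0 h1)

lemma dim_div_mul_ellStar_div_le (hd : 1 ≤ d) (hdn : d ≤ n) (h0 : 0 ≤ δ) {r : ℝ}
    (hdim : (d : ℝ) / n * (d / n) ≤ r) (hflip : δ * (d / n) ≤ r)
    (hnorm : ‖θ‖ ^ 2 * (d / n) ≤ r) :
    (d : ℝ) / n * (ellStar n δ θ / n) ≤ 4 * r := by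
  have hmul := mul_le_mul_of_nonneg_left (ellStar_div_le (θ := θ) hd hdn h0)
    (show 0 ≤ (d : ℝ) / n by positivity)
  linarith

end NumberOfBuckets

section Regimes

variable {n d : ℕ} {δ E : ℝ} {θ : EuclideanSpace ℝ (Fin d)} {h : Fin n → ℝ}
  {z : Fin n → EuclideanSpace ℝ (Fin d)}
  {vmax : Matrix (Fin d) (Fin d) ℝ → EuclideanSpace ℝ (Fin d)}

namespace IsGoodSample

lemma loss_thetaHat_ellStar_sq_le (hs : IsGoodSample (ellStar n δ θ) E h z)
    (hv : IsTopEigenvectorMap vmax) (hd : 1 ≤ d) (hdn : d ≤ n) (h0 : 0 ≤ δ)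
    (hE : Real.exp (-1) * ellStar n δ θ ≤ E) {ρ : ℝ} (hρ : 0 ≤ ρ)
    (henergy : bucketLength n (ellStar n δ θ) = 1 ∨ √(d / ellStar n δ θ) * ‖θ‖ ^ 2 ≤ ρ)
    (hdim : (d : ℝ) / n * (d / n) ≤ ρ ^ 2) (hflip : δ * (d / n) ≤ ρ ^ 2)
    (hnorm : ‖θ‖ ^ 2 * (d / n) ≤ ρ ^ 2) :
    loss (thetaHat vmax (ellStar n δ θ) E fun j => h j • θ + z j) θ ^ 2 ≤ 60129 * ρ ∧
      loss (thetaHat vmax (ellStar n δ θ) E fun j => h j • θ + z j) θ ^ 2 * ‖θ‖ ^ 2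
        ≤ 12 * (20043 * ρ) ^ 2 :=
  hs.loss_thetaHat_sq_le hv (hd.trans le_ellStar) (ellStar_le hdn) hE hρ henergy hnorm
    (dim_div_mul_ellStar_div_le hd hdn h0 hdim hflip hnorm)

lemma loss_thetaHat_sq_lt_of_norm_sq_le (hs : IsGoodSample (ellStar n δ θ) E h z)
    (hv : IsTopEigenvectorMap vmax) (hd : 1 ≤ d) (hdn : d ≤ n) (h0 : 0 ≤ δ)
    (hE : Real.exp (-1) * ellStar n δ θ ≤ E)
    (hθ : ‖θ‖ ^ 2 ≤ max √(δ * d / n) ((d : ℝ) / n)) :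
    loss (thetaHat vmax (ellStar n δ θ) E fun j => h j • θ + z j) θ ^ 2
      < 10 ^ 10 * (√(δ * d / n) + (d : ℝ) / n) := by
  have hn := hd.trans hdn
  have hl : 0 < ellStar n δ θ := hd.trans le_ellStar
  have hsqrt : √(δ * d / n) ^ 2 = δ * (d / n) := by
    rw [Real.sq_sqrt (by positivity), mul_div_assoc]
  set D := (d : ℝ) / n
  set R := √(δ * d / n) + D
  have hD : 0 < D := by positivity
  have hs0 : 0 ≤ √(δ * d / n) := Real.sqrt_nonneg _
  have hθR : ‖θ‖ ^ 2 ≤ R := hθ.trans (max_le_add_of_nonneg hs0 hD.le)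
  have hsmall : √(d / ellStar n δ θ) ≤ 1 := by
    refine Real.sqrt_le_one.2 ((div_le_one (by positivity)).2 ?_)
    exact_mod_cast le_ellStar
  have hloss := (hs.loss_thetaHat_ellStar_sq_le hv hd hdn h0 hE (ρ := R) (by positivity)
    (.inr ?_) ?_ ?_ ?_).1
  · linarith [show 0 < R by positivity]
  · exact (mul_le_of_le_one_left (sq_nonneg _) hsmall).trans hθR
  · nlinarith
  · nlinarith
  · rw [sq R]
    gcongr
    linarith

lemma loss_thetaHat_sq_lt_of_le_norm_sq_of_norm_sq_le (hs : IsGoodSample (ellStar n δ θ) E h z)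
    (hv : IsTopEigenvectorMap vmax) (hd : 1 ≤ d) (hdn : d ≤ n) (h1 : δ ≤ 1)
    (hE : Real.exp (-1) * ellStar n δ θ ≤ E) (hDδ : (d : ℝ) / n ≤ δ)
    (hDθ : (d : ℝ) / n ≤ ‖θ‖ ^ 2) (hθδ : ‖θ‖ ^ 2 ≤ δ) :
    loss (thetaHat vmax (ellStar n δ θ) E fun j => h j • θ + z j) θ ^ 2
      < 10 ^ 10 * (δ * d / n / ‖θ‖ ^ 2) := by
  have hn := hd.trans hdn
  have hl : 0 < ellStar n δ θ := hd.trans le_ellStar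
  have hD : 0 < (d : ℝ) / n := by positivity
  have hδ : 0 < δ := hD.trans_le hDδ
  have hθ : 0 < ‖θ‖ ^ 2 := hD.trans_le hDθ
  have hsq : √(δ * (d / n)) ^ 2 = δ * (d / n) := Real.sq_sqrt (by positivity)
  have henergy : √(d / ellStar n δ θ) * ‖θ‖ ^ 2 ≤ √(δ * (d / n)) := by
    refine sqrt_div_mul_le_sqrt_mul_div (by positivity) (by positivity) (by positivity) ?_
    calc (‖θ‖ ^ 2) ^ 2 * n ≤ δ ^ 2 * n := by gcongr
      _ = δ * (n * δ) := by ring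
      _ ≤ δ * ellStar n δ θ := by
        gcongr
        exact mul_le_ellStar h1
  have hloss := (hs.loss_thetaHat_ellStar_sq_le hv hd hdn hδ.le hE (Real.sqrt_nonneg _)
    (.inr henergy) (by rw [hsq]; gcongr) hsq.ge (by rw [hsq]; gcongr)).2
  rw [mul_pow, hsq] at hloss
  rw [← mul_div_assoc, lt_div_iff₀ hθ, mul_div_assoc δ]
  linarith [show 0 < δ * (d / n) by positivity]

lemma loss_thetaHat_sq_lt_of_le_norm_sq (hs : IsGoodSample (ellStar n δ θ) E h z)
    (hv : IsTopEigenvectorMap vmax) (hd : 1 ≤ d) (hdn : d ≤ n) (h0 : 0 ≤ δ)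
    (hE : Real.exp (-1) * ellStar n δ θ ≤ E) (hθ : max δ ((d : ℝ) / n) ≤ ‖θ‖ ^ 2) :
    loss (thetaHat vmax (ellStar n δ θ) E fun j => h j • θ + z j) θ ^ 2
      < 10 ^ 10 * ((d : ℝ) / n) := by
  have hn := hd.trans hdn
  have hl : 0 < ellStar n δ θ := hd.trans le_ellStar
  have hD : 0 < (d : ℝ) / n := by positivity
  have hδθ : δ ≤ ‖θ‖ ^ 2 := (le_max_left _ _).trans hθ
  have hDθ : (d : ℝ) / n ≤ ‖θ‖ ^ 2 := (le_max_right _ _).trans hθ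
  have hθ_pos : 0 < ‖θ‖ ^ 2 := hD.trans_le hDθ
  have hsq : √(‖θ‖ ^ 2 * (d / n)) ^ 2 = ‖θ‖ ^ 2 * (d / n) := Real.sq_sqrt (by positivity)
  have henergy : bucketLength n (ellStar n δ θ) = 1 ∨
      √(d / ellStar n δ θ) * ‖θ‖ ^ 2 ≤ √(‖θ‖ ^ 2 * (d / n)) := by
    rcases (ellStar_le hdn).eq_or_lt with heq | hlt
    · exact .inl (by rw [heq, bucketLength, Nat.div_self hn])
    · refine .inr (sqrt_div_mul_le_sqrt_mul_div (by positivity) (by positivity)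
        (by positivity) ?_)
      nlinarith [mul_norm_sq_le_ellStar_of_lt hlt]
  have hloss := (hs.loss_thetaHat_ellStar_sq_le hv hd hdn h0 hE (Real.sqrt_nonneg _)
    henergy (by rw [hsq]; gcongr) (by rw [hsq]; gcongr) hsq.ge).2
  rw [mul_pow, hsq] at hloss
  refine lt_of_mul_lt_mul_right (hloss.trans_lt ?_) hθ_pos.le
  linarith [show 0 < ‖θ‖ ^ 2 * (d / n) by positivity]

lemma loss_thetaHat_sq_lt_localRate (hs : IsGoodSample (ellStar n δ θ) E h z)
    (hv : IsTopEigenvectorMap vmax) (hd : 1 ≤ d) (hdn : d ≤ n) (h0 : 0 ≤ δ) (h1 : δ ≤ 1)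
    (hE : Real.exp (-1) * ellStar n δ θ ≤ E) :
    loss (thetaHat vmax (ellStar n δ θ) E fun j => h j • θ + z j) θ ^ 2
      < 10 ^ 10 * localRate n δ θ := by
  unfold localRate
  split_ifs with hsmall hmedium
  · exact hs.loss_thetaHat_sq_lt_of_norm_sq_le hv hd hdn h0 hE hsmall
  · have hDθ : (d : ℝ) / n < ‖θ‖ ^ 2 := (max_lt_iff.1 (not_le.1 hsmall)).2
    have hθδ : ‖θ‖ ^ 2 ≤ δ := (le_max_iff.1 hmedium).resolve_right hDθ.not_ge
    exact hs.loss_thetaHat_sq_lt_of_le_norm_sq_of_norm_sq_le hv hd hdn h1 hE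
      (hDθ.le.trans hθδ) hDθ.le hθδ
  · exact hs.loss_thetaHat_sq_lt_of_le_norm_sq hv hd hdn h0 hE (not_le.1 hmedium).le

end IsGoodSample

lemma localRate_le_globalRate (n : ℕ) {d : ℕ} {δ : ℝ} (h0 : 0 ≤ δ)
    (θ : EuclideanSpace ℝ (Fin d)) : localRate n δ θ ≤ globalRate n d δ := by
  have hD : 0 ≤ (d : ℝ) / n := by positivity
  have hs := Real.sqrt_nonneg (δ * d / n)
  unfold localRate
  split_ifs with hsmall hmedium
  · exact le_rfl
  · have hlt : √(δ * d / n) < ‖θ‖ ^ 2 := (max_lt_iff.1 (not_le.1 hsmall)).1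
    calc δ * d / n / ‖θ‖ ^ 2 = √(δ * d / n) * √(δ * d / n) / ‖θ‖ ^ 2 := by
          rw [Real.mul_self_sqrt (by positivity)]
      _ ≤ √(δ * d / n) := div_le_of_le_mul₀ (sq_nonneg _) hs (by gcongr)
      _ ≤ globalRate n d δ := le_add_of_nonneg_right hD
  · exact le_add_of_nonneg_left hs

end Regimes

end MarkovMixture

end

open MarkovMixture in
theorem proposition1_general :
    ∃ C c₀ c₁ : ℝ, 0 < C ∧ 0 < c₀ ∧ 0 < c₁ ∧
      ∀ (n d : ℕ), 1 ≤ d → d ≤ n → ∀ δ : ℝ, 0 ≤ δ → δ ≤ 1 →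
      ∀ (Ω : Type*) [MeasurableSpace Ω] (μ : Measure Ω)
        (η : Fin n → Ω → ℝ) (ξ : Fin n → Ω → EuclideanSpace ℝ (Fin d)),
      IsSymmetricChain μ δ η → IsIndepSubGaussian μ ξ →
      IndepFun (fun ω i => η i ω) (fun ω i => ξ i ω) μ →
      ∀ vmax : Matrix (Fin d) (Fin d) ℝ → EuclideanSpace ℝ (Fin d), IsTopEigenvectorMap vmax →
      (∀ θ : EuclideanSpace ℝ (Fin d),
        (‖θ‖ ^ 2 ≤ max √(δ * d / n) ((d : ℝ) / n) →
          μ {ω | ¬ loss (oracle μ δ η ξ vmax θ ω) θ ^ 2 ≤ C * (√(δ * d / n) + (d : ℝ) / n)}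
            ≤ ENNReal.ofReal (c₁ * Real.exp (-(c₀ * d)))) ∧
        ((d : ℝ) / n ≤ δ → max √(δ * d / n) ((d : ℝ) / n) ≤ ‖θ‖ ^ 2 →
          ‖θ‖ ^ 2 ≤ max δ ((d : ℝ) / n) →
          μ {ω | ¬ loss (oracle μ δ η ξ vmax θ ω) θ ^ 2 ≤ C * ((δ * d / n) / ‖θ‖ ^ 2)}
            ≤ ENNReal.ofReal (c₁ * Real.exp (-(c₀ * d)))) ∧
        (max δ ((d : ℝ) / n) ≤ ‖θ‖ ^ 2 →
          μ {ω | ¬ loss (oracle μ δ η ξ vmax θ ω) θ ^ 2 ≤ C * ((d : ℝ) / n)}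
            ≤ ENNReal.ofReal (c₁ * Real.exp (-(c₀ * d)))) ∧
        μ {ω | ¬ loss (oracle μ δ η ξ vmax θ ω) θ ^ 2 ≤ C * (√(δ * d / n) + (d : ℝ) / n)}
          ≤ ENNReal.ofReal (c₁ * Real.exp (-(c₀ * d)))) ∧
      IsLocallyMinimaxOptimal μ n δ (oracle μ δ η ξ vmax) C c₀ c₁ ∧
      IsGloballyMinimaxOptimal μ n δ (oracle μ δ η ξ vmax) C c₀ c₁ := by
  refine ⟨10 ^ 10, 1, 8, by positivity, one_pos, by positivity, ?_⟩
  intro n d hd hdn δ h0 h1 Ω _ μ η ξ hη hξ hind vmax hv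
  have := hξ.indep.isProbabilityMeasure
  have hE := fun θ => hη.exp_neg_one_mul_ellStar_le_expSqNorm hd hdn h0 h1 (θ := θ)
  have hprob : ∀ θ {s : Set Ω}, (∀ ω, IsGoodSample (ellStar n δ θ)
      (expSqNorm μ (ellStar n δ θ) η) (fun i => η i ω) (fun i => ξ i ω) → ω ∉ s) →
      μ s ≤ ENNReal.ofReal (8 * Real.exp (-(1 * d))) := fun θ s hs => by
    rw [one_mul]
    exact (measure_mono fun ω hω hgood => hs ω hgood hω).trans
      (measure_not_isGoodSample_le hη hξ hind h0 h1 (hd.trans le_ellStar) le_ellStar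
        (ellStar_le hdn))
  have hlocal := fun θ ω hs => IsGoodSample.loss_thetaHat_sq_lt_localRate (θ := θ)
    (h := fun i => η i ω) (z := fun i => ξ i ω) hs hv hd hdn h0 h1 (hE θ)
  have hglobal := fun θ ω hs => (hlocal θ ω hs).trans_le
    (mul_le_mul_of_nonneg_left (localRate_le_globalRate n h0 θ) (by positivity))
  refine ⟨fun θ => ⟨fun hθ => ?_, fun hDδ hDθ hθδ => ?_, fun hθ => ?_, ?_⟩,
    iSup_le fun θ => hprob θ fun ω hs => (hlocal θ ω hs).not_ge,
    iSup_le fun θ => hprob θ fun ω hs => (hglobal θ ω hs).not_ge⟩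
  · exact hprob θ fun ω hs =>
      not_not.2 (hs.loss_thetaHat_sq_lt_of_norm_sq_le hv hd hdn h0 (hE θ) hθ).le
  · exact hprob θ fun ω hs =>
      not_not.2 (hs.loss_thetaHat_sq_lt_of_le_norm_sq_of_norm_sq_le hv hd hdn h1 (hE θ) hDδ
        ((le_max_right _ _).trans hDθ) (hθδ.trans_eq (max_eq_left hDδ))).le
  · exact hprob θ fun ω hs =>
      not_not.2 (hs.loss_thetaHat_sq_lt_of_le_norm_sq hv hd hdn h0 (hE θ) hθ).le
  · exact hprob θ fun ω hs => not_not.2 (hglobal θ ω hs).le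

theorem proposition1 :
    ∃ C c₀ c₁ : ℝ, 0 < C ∧ 0 < c₀ ∧ 0 < c₁ ∧
      ∀ (n d : ℕ), 1 ≤ d → d ≤ n → ∀ δ : ℝ, 0 < δ → δ < 1 / 2 →
      ∀ (Ω : Type*) [MeasurableSpace Ω] (μ : Measure Ω) [IsProbabilityMeasure μ]
        (η : Fin n → Ω → ℝ) (ξ : Fin n → Ω → EuclideanSpace ℝ (Fin d)),
      MarkovMixture.IsModel μ δ η ξ →
      ∀ vmax : Matrix (Fin d) (Fin d) ℝ → EuclideanSpace ℝ (Fin d),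
      MarkovMixture.IsTopEigenvectorMap vmax →
      -- the three regimes
      (∀ θ : EuclideanSpace ℝ (Fin d),
        (‖θ‖ ^ 2 ≤ max (Real.sqrt (δ * d / n)) ((d : ℝ) / n) →
          μ {ω | ¬ MarkovMixture.loss (MarkovMixture.oracle μ δ η ξ vmax θ ω) θ ^ 2
                ≤ C * (Real.sqrt (δ * d / n) + (d : ℝ) / n)}
            ≤ ENNReal.ofReal (c₁ * Real.exp (-(c₀ * d)))) ∧
        ((d : ℝ) / n ≤ δ →
          max (Real.sqrt (δ * d / n)) ((d : ℝ) / n) ≤ ‖θ‖ ^ 2 →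
          ‖θ‖ ^ 2 ≤ max δ ((d : ℝ) / n) →
          μ {ω | ¬ MarkovMixture.loss (MarkovMixture.oracle μ δ η ξ vmax θ ω) θ ^ 2
                ≤ C * ((δ * d / n) / ‖θ‖ ^ 2)}
            ≤ ENNReal.ofReal (c₁ * Real.exp (-(c₀ * d)))) ∧
        (max δ ((d : ℝ) / n) ≤ ‖θ‖ ^ 2 →
          μ {ω | ¬ MarkovMixture.loss (MarkovMixture.oracle μ δ η ξ vmax θ ω) θ ^ 2
                ≤ C * ((d : ℝ) / n)}
            ≤ ENNReal.ofReal (c₁ * Real.exp (-(c₀ * d)))) ∧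
        -- the global bound
        μ {ω | ¬ MarkovMixture.loss (MarkovMixture.oracle μ δ η ξ vmax θ ω) θ ^ 2
              ≤ C * (Real.sqrt (δ * d / n) + (d : ℝ) / n)}
          ≤ ENNReal.ofReal (c₁ * Real.exp (-(c₀ * d)))) ∧
      -- local and global minimax optimality
      MarkovMixture.IsLocallyMinimaxOptimal μ n δ
        (MarkovMixture.oracle μ δ η ξ vmax) C c₀ c₁ ∧
      MarkovMixture.IsGloballyMinimaxOptimal μ n δ
        (MarkovMixture.oracle μ δ η ξ vmax) C c₀ c₁ := by
  obtain ⟨C, c₀, c₁, hC, hc₀, hc₁, hbound⟩ := proposition1_general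
  exact ⟨C, c₀, c₁, hC, hc₀, hc₁, fun n d hd hdn δ h0 h1 Ω _ μ _ η ξ hM => hbound n d hd hdn δ
    h0.le (by linarith) Ω μ η ξ hM.chain hM.noise.isIndepSubGaussian hM.indep⟩
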